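/- **Quantile-based persuasion.** Let $\mathcal F_0$ be the set of cumulative distribution functions on $\mathbb R$ (identified with the probability measures on $\mathbb R$), let $F\in\mathcal F_0$ have full support on some interval, and let $\tau\in(0,1)$. For $G\in\mathcal F_0$ and $q\in(0,1)$ let $G^{-1}(q)=\inf\{x: G(x)\ge q\}$, and let $G^{-1}(\tau^+)=\lim_{q\downarrow\tau}G^{-1}(q)$. A $\tau$-quantile selection rule is a transition probability $r$ from $\mathcal F_0$ to $\mathbb R$ such that $r(\cdot\mid G)$ assigns probability one to $[G^{-1}(\tau),G^{-1}(\tau^+)]$ for every $G\in\mathcal F_0$. Suppose that $r$ is a $\tau$-quantile selection rule, that $v_S:\mathbb R\to\mathbb R$ is measurable and integrable with respect to $r(\cdot\mid G)$ for every $G\in\mathcal F_0$, and that the sender's indirect utility $\hat v:\mathcal F_0\to\mathbb R$ is given by $$\hat v(G)=\int_{\mathbb R}v_S(x)\,r(dx\mid G)\qquad\text{for all }G\in\mathcal F_0 .$$ Let $F_L^\tau(\omega)=\min\{F(\omega)/\tau,\,1\}$ and $F_R^\tau(\omega)=\max\{(F(\omega)-\tau)/(1-\tau),\,0\}$, and let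 $\mathcal I(F_R^\tau,F_L^\tau)$ be the set of nondecreasing right-continuous functions $H:\mathbb R\to\mathbb R$ with $F_R^\tau\le H\le F_L^\tau$ pointwise. Let $$\mathrm{cav}(\hat v)[F]=\sup\{z\in\mathbb R:\ (F,z)\in\mathrm{co}(\mathrm{graph}\,\hat v)\}$$ be the concave closure of $\hat v$ at $F$, where $\mathrm{co}$ denotes the convex hull. Let $\mathcal M$ be the set of signals for $F$, that is, of probability measures $\mu$ on $\mathcal F_0$ with $\int G(\omega)\,\mu(dG)=F(\omega)$ for all $\omega\in\mathbb R$. Then $$\mathrm{cav}(\hat v)[F]\;=\;\sup_{\mu\in\mathcal M}\int_{\mathcal F_0}\hat v(G)\,\mu(dG)\;=\;\sup_{H\in\mathcal I(F_R^\tau,F_L^\tau)}\int_{\mathbb R}v_S(\omega)\,H(d\omega).$$ All suprema are taken in the extended reals; an integral $\int f$ means $\int f^+-\int f^-$, and those $\mu$ and $H$ for which it is undefined ($\infty-\infty$) are disregarded. -/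

import Mathlib

open MeasureTheory ProbabilityTheory

/-- `F` has full support on the set `J`: all the mass of `F` is on `J`, and every nonempty
relatively open subset of `J` has positive mass. -/
def HasFullSupportOn (F : Measure ℝ) (J : Set ℝ) : Prop :=
  F J = 1 ∧ ∀ U : Set ℝ, IsOpen U → (U ∩ J).Nonempty → 0 < F (U ∩ J)

/-- The quantile function `G⁻¹(q) = inf {x | G(x) ≥ q}`, for `q ∈ (0, 1)`. A CDF is represented by
the probability measure on `ℝ` that it determines; the CDF itself is `cdf G`. -/
noncomputable def quantile (G : ProbabilityMeasure ℝ) (q : ℝ) : ℝ :=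
  sInf {x : ℝ | q ≤ cdf (G : Measure ℝ) x}

/-- The set `[G⁻¹(τ), G⁻¹(τ⁺)]` of `τ`-quantiles of `G`, for `τ ∈ (0, 1)`. -/
noncomputable def quantileSet (τ : ℝ) (G : ProbabilityMeasure ℝ) : Set ℝ :=
  Set.Icc (quantile G τ) (Function.rightLim (quantile G) τ)

/-- A `τ`-quantile selection rule: a transition probability from CDFs to `ℝ` that, for every `G`,
puts probability one on the set of `τ`-quantiles of `G`. -/
def IsQuantileSelectionRule (τ : ℝ) (r : Kernel (ProbabilityMeasure ℝ) ℝ) : Prop :=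
  IsMarkovKernel r ∧ ∀ G : ProbabilityMeasure ℝ, r G (quantileSet τ G) = 1

/-- A signal for the prior `F`: a probability distribution over posteriors that average to `F`. -/
def IsSignal (F : ProbabilityMeasure ℝ) (μ : Measure (ProbabilityMeasure ℝ)) : Prop :=
  IsProbabilityMeasure μ ∧
    ∀ ω : ℝ, ∫ G : ProbabilityMeasure ℝ, cdf (G : Measure ℝ) ω ∂μ = cdf (F : Measure ℝ) ω

/-- The left-truncation `F_L^τ(ω) = min {F(ω) / τ, 1}`. -/
noncomputable def leftTruncation (τ : ℝ) (F : ProbabilityMeasure ℝ) (ω : ℝ) : ℝ :=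
  min (1 / τ * cdf (F : Measure ℝ) ω) 1

/-- The right-truncation `F_R^τ(ω) = max {(F(ω) - τ) / (1 - τ), 0}`. -/
noncomputable def rightTruncation (τ : ℝ) (F : ProbabilityMeasure ℝ) (ω : ℝ) : ℝ :=
  max ((cdf (F : Measure ℝ) ω - τ) / (1 - τ)) 0

/-- The interval of nondecreasing right-continuous functions lying pointwise between two given
functions. -/
def monotoneInterval (lower upper : ℝ → ℝ) : Set (StieltjesFunction ℝ) :=
  {H | ∀ x : ℝ, lower x ≤ H x ∧ H x ≤ upper x}

/-- The integral with values in the extended reals, `∫ f⁺ dμ - ∫ f⁻ dμ`. In `EReal` one has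
`⊤ - ⊤ = ⊥`, so an undefined integral counts as `-∞` and never contributes to a supremum that
ranges over at least one measure with a well-defined integral. -/
noncomputable def extIntegral {α : Type*} [MeasurableSpace α] (f : α → ℝ) (μ : Measure α) : EReal :=
  ((∫⁻ x, ENNReal.ofReal (f x) ∂μ : ENNReal) : EReal) -
    ((∫⁻ x, ENNReal.ofReal (-f x) ∂μ : ENNReal) : EReal)

/-- The concave closure of `w` at `F`: the supremum of all `z` such that `(F, z)` lies in the convex
hull of the graph of `w`, where the domain of `w` is the convex set of CDFs in the vector space of
functions `ℝ → ℝ`. -/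
noncomputable def concaveClosure (w : ProbabilityMeasure ℝ → ℝ) (F : ProbabilityMeasure ℝ) :
    EReal :=
  ⨆ (z : ℝ) (_ : ((cdf (F : Measure ℝ) : ℝ → ℝ), z) ∈ convexHull ℝ
    (Set.range fun G : ProbabilityMeasure ℝ => ((cdf (G : Measure ℝ) : ℝ → ℝ), w G))), (z : EReal)

/-- The value of persuasion with indirect utility `w` at the prior `F`: the supremum, over all
signals, of the expectation of `w` under the distribution of posteriors. -/
noncomputable def persuasionValue (w : ProbabilityMeasure ℝ → ℝ) (F : ProbabilityMeasure ℝ) :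
    EReal :=
  ⨆ (μ : Measure (ProbabilityMeasure ℝ)) (_ : IsSignal F μ), extIntegral w μ

open Set Filter Topology

/-! Under a signal the selected posterior quantile has a law `H`, and the sender's expected payoff
is `∫ v_S dH` when `v_S` is `H`-integrable. The point is that these laws fill the interval between
the truncations, up to approximation.

Every such law lies in the interval. A selected `τ`-quantile of `G` can be at most `x` only if `G x
≥ τ`, and must be if `G x > τ`. So its conditional probability of being at most `x` lies between `(G
x - τ) / (1 - τ)` and `G x / τ`, and averaging over the signal replaces `G` by `F`
(`IsSignal.exists_mem_monotoneInterval`).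

Conversely, write `∫ v_S dH` as the integral of `v_S (H⁻¹ u)` over `u ∈ (0, 1)`. The truncation
bounds make `H⁻¹ u` the point where `F` crosses some level `v ∈ [τ u, τ + (1 - τ) u]`
(`exists_isCrossing_of_truncation`). In level space `[0, 1]`, where the prior acts as the uniform
law, pair a slice of `[0, τ]` lying below `v` with a slice of `[τ, 1]` lying above it, in
proportions `τ : 1 - τ`. The resulting posterior has `H⁻¹ u` among its `τ`-quantiles, and finitely
many such posteriors yield a Riemann sum of the integral (`riemann_sum_le_concaveClosure`).

These posteriors have a gap around `v`, so the rule might select another quantile. A small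
perturbation makes them strictly increasing in the level. Full support then makes the quantile
unique, so the rule has no choice (`sum_le_concaveClosure_of_monotoneOn`). Only finite
decompositions are used, so the bound is on the concave closure itself. General signals matter only
for the upper bound, and divergent integrals are handled by truncating `v_S`. -/

/-! ### Quantiles and quantile selection rules -/

theorem quantile_le_iff (G : ProbabilityMeasure ℝ) {q : ℝ} (hq : q ∈ Ioo (0 : ℝ) 1) (x : ℝ) :
    quantile G q ≤ x ↔ q ≤ cdf (G : Measure ℝ) x := by
  have hmono := monotone_cdf (G : Measure ℝ)
  have hne : {x : ℝ | q ≤ cdf (G : Measure ℝ) x}.Nonempty := by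
    obtain ⟨y, hy⟩ := ((tendsto_cdf_atTop (G : Measure ℝ)).eventually (lt_mem_nhds hq.2)).exists
    exact ⟨y, hy.le⟩
  have hbdd : BddBelow {x : ℝ | q ≤ cdf (G : Measure ℝ) x} := by
    obtain ⟨y, hy⟩ := ((tendsto_cdf_atBot (G : Measure ℝ)).eventually (gt_mem_nhds hq.1)).exists
    exact ⟨y, fun z hz => le_of_not_gt fun h => (hy.trans_le hz).not_ge (hmono h.le)⟩
  constructor
  · intro h
    refine le_trans ?_ (hmono h)
    -- Right continuity makes the infimum attained, which gives the equivalence with a weak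
    -- inequality.
    have hcont := ((cdf (G : Measure ℝ)).right_continuous (quantile G q)).mono
      (Ioi_subset_Ici le_rfl)
    refine ge_of_tendsto hcont ?_
    filter_upwards [self_mem_nhdsWithin] with y hy
    obtain ⟨z, hz, hzy⟩ := exists_lt_of_csInf_lt hne hy
    exact le_trans hz (hmono hzy.le)
  · intro h
    exact csInf_le hbdd h

theorem lt_quantile_iff (G : ProbabilityMeasure ℝ) {q : ℝ} (hq : q ∈ Ioo (0 : ℝ) 1) (x : ℝ) :
    x < quantile G q ↔ cdf (G : Measure ℝ) x < q := by
  rw [← not_le, quantile_le_iff G hq, not_le]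

theorem monotoneOn_quantile (G : ProbabilityMeasure ℝ) : MonotoneOn (quantile G) (Ioo 0 1) := by
  intro p hp q hq hpq
  rw [quantile_le_iff G hp]
  exact hpq.trans ((quantile_le_iff G hq _).1 le_rfl)

theorem tendsto_quantile_rightLim (G : ProbabilityMeasure ℝ) {τ : ℝ} (hτ : τ ∈ Ioo (0 : ℝ) 1) :
    Tendsto (quantile G) (𝓝[>] τ) (𝓝 (Function.rightLim (quantile G) τ)) := by
  -- `quantile G` is monotone only on `(0, 1)`, since outside it `sInf` may return its default
  -- value. The limit is therefore taken along `Ioo τ 1`.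
  have hsub : Ioo τ 1 ⊆ Ioo 0 1 := Ioo_subset_Ioo_left hτ.1.le
  have h := ((monotoneOn_quantile G).mono hsub).tendsto_nhdsWithin_Ioo_right
    (nonempty_Ioo.2 hτ.2) ⟨quantile G τ, by
      rintro _ ⟨q, hq, rfl⟩
      exact monotoneOn_quantile G hτ (hsub hq) hq.1.le⟩
  rwa [rightLim_eq_of_tendsto h]

theorem rightLim_quantile_le (G : ProbabilityMeasure ℝ) {τ : ℝ} (hτ : τ ∈ Ioo (0 : ℝ) 1) {x : ℝ}
    (hx : τ < cdf (G : Measure ℝ) x) : Function.rightLim (quantile G) τ ≤ x := by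
  refine le_of_tendsto (tendsto_quantile_rightLim G hτ) ?_
  filter_upwards [Ioo_mem_nhdsGT (lt_min hx hτ.2)] with q hq
  have h := lt_min_iff.1 hq.2
  exact (quantile_le_iff G ⟨hτ.1.trans hq.1, h.2⟩ x).2 h.1.le

/-- A distribution whose CDF is below `τ` to the left of `x` and above `τ` to its right has `x` as
its only `τ`-quantile. -/
theorem quantileSet_subset_singleton (G : ProbabilityMeasure ℝ) {τ : ℝ} (hτ : τ ∈ Ioo (0 : ℝ) 1)
    {x : ℝ} (hl : ∀ y < x, cdf (G : Measure ℝ) y < τ) (hg : ∀ y > x, τ < cdf (G : Measure ℝ) y) :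
    quantileSet τ G ⊆ {x} := by
  intro z hz
  refine le_antisymm ?_ ?_
  · exact hz.2.trans (le_of_forall_gt_imp_ge_of_dense fun y hy => rightLim_quantile_le G hτ (hg y hy))
  · refine le_trans (le_of_forall_lt_imp_le_of_dense fun y hy => ?_) hz.1
    exact ((lt_quantile_iff G hτ y).2 (hl y hy)).le

theorem measurableSet_quantileSet (τ : ℝ) (G : ProbabilityMeasure ℝ) :
    MeasurableSet (quantileSet τ G) := measurableSet_Icc

theorem IsQuantileSelectionRule.apply_eq_zero {τ : ℝ} {r : Kernel (ProbabilityMeasure ℝ) ℝ}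
    (hr : IsQuantileSelectionRule τ r) {G : ProbabilityMeasure ℝ} {s : Set ℝ}
    (hs : Disjoint s (quantileSet τ G)) : r G s = 0 := by
  have := hr.1
  have h : r G (quantileSet τ G)ᶜ = 0 :=
    (prob_compl_eq_zero_iff (measurableSet_quantileSet τ G)).2 (hr.2 G)
  exact measure_mono_null hs.subset_compl_right h

theorem IsQuantileSelectionRule.integral_eq {τ : ℝ} {r : Kernel (ProbabilityMeasure ℝ) ℝ}
    (hr : IsQuantileSelectionRule τ r) {G : ProbabilityMeasure ℝ} {x : ℝ}
    (hx : quantileSet τ G ⊆ {x}) (f : ℝ → ℝ) : ∫ y, f y ∂(r G) = f x := by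
  have := hr.1
  have h : r G ({x}ᶜ) = 0 := hr.apply_eq_zero (disjoint_left.2 fun y hy hy' => hy (hx hy'))
  have h' : f =ᵐ[r G] fun _ => f x := by
    filter_upwards [compl_mem_ae_iff.2 h] with y hy
    rw [compl_compl] at hy
    rw [hy]
  rw [integral_congr_ae h']
  simp

/-- The probability that a selected `τ`-quantile of `G` is at most `x` is at most `G x / τ`. -/
theorem IsQuantileSelectionRule.real_Iic_le {τ : ℝ} (hτ : τ ∈ Ioo (0 : ℝ) 1)
    {r : Kernel (ProbabilityMeasure ℝ) ℝ} (hr : IsQuantileSelectionRule τ r)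
    (G : ProbabilityMeasure ℝ) (x : ℝ) :
    (r G).real (Iic x) ≤ 1 / τ * cdf (G : Measure ℝ) x := by
  have := hr.1
  rcases lt_or_ge (cdf (G : Measure ℝ) x) τ with h | h
  · have h0 : r G (Iic x) = 0 := hr.apply_eq_zero (disjoint_left.2 fun y hy hy' =>
      (((lt_quantile_iff G hτ x).2 h).trans_le hy'.1).not_ge hy)
    rw [measureReal_def, h0, ENNReal.toReal_zero]
    exact mul_nonneg (one_div_nonneg.2 hτ.1.le) (cdf_nonneg _ _)
  · refine measureReal_le_one.trans ?_
    rw [one_div, ← div_eq_inv_mul]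
    exact (one_le_div hτ.1).2 h

/-- The probability that a selected `τ`-quantile of `G` is at most `x` is at least
`(G x - τ) / (1 - τ)`. -/
theorem IsQuantileSelectionRule.le_real_Iic {τ : ℝ} (hτ : τ ∈ Ioo (0 : ℝ) 1)
    {r : Kernel (ProbabilityMeasure ℝ) ℝ} (hr : IsQuantileSelectionRule τ r)
    (G : ProbabilityMeasure ℝ) (x : ℝ) :
    (cdf (G : Measure ℝ) x - τ) / (1 - τ) ≤ (r G).real (Iic x) := by
  have := hr.1
  have h1 : 0 < 1 - τ := sub_pos.2 hτ.2
  rcases le_or_gt (cdf (G : Measure ℝ) x) τ with h | h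
  · exact (div_nonpos_of_nonpos_of_nonneg (sub_nonpos.2 h) h1.le).trans measureReal_nonneg
  · have h0 : r G (Ioi x) = 0 := hr.apply_eq_zero (disjoint_left.2 fun y hy hy' =>
      (hy'.2.trans (rightLim_quantile_le G hτ h)).not_gt hy)
    have h2 : (r G).real (Iic x) = 1 := by
      rw [← compl_Ioi, probReal_compl_eq_one_sub measurableSet_Ioi, measureReal_def, h0]
      simp
    rw [h2, div_le_one h1]
    linarith [cdf_le_one (G : Measure ℝ) x]

/-! ### Levels and crossing points of the prior -/

/-- `x` is the point at which the CDF of `F` crosses the level `v`, and the only one. -/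
def IsCrossing (F : ProbabilityMeasure ℝ) (v x : ℝ) : Prop :=
  (∀ y < x, cdf (F : Measure ℝ) y < v) ∧ ∀ y > x, v < cdf (F : Measure ℝ) y

/-- A CDF value strictly between 0 and 1 forces `J` to have points on both sides of `x`. An interval
has no gaps, so `J` meets `Ioo x y`, which then carries mass. -/
theorem cdf_lt_cdf_of_fullSupport {F : ProbabilityMeasure ℝ} {J : Set ℝ} (hJ : J.OrdConnected)
    (hF : HasFullSupportOn (F : Measure ℝ) J) {x y : ℝ} (hxy : x < y)
    (h0 : 0 < cdf (F : Measure ℝ) x) (h1 : cdf (F : Measure ℝ) x < 1) :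
    cdf (F : Measure ℝ) x < cdf (F : Measure ℝ) y := by
  have hJc : (F : Measure ℝ) Jᶜ = 0 := (prob_compl_eq_zero_iff hJ.measurableSet).2 hF.1
  have hIcc : ∃ z ∈ J, z ≤ x := by
    by_contra! h
    have h2 : (F : Measure ℝ) (Iic x) = 0 :=
      measure_mono_null (fun z hz hzJ => (h z hzJ).not_ge hz) hJc
    rw [cdf_eq_real, measureReal_def, h2] at h0
    simp at h0
  have hJu : ∃ z ∈ J, x < z := by
    by_contra! h
    have h2 : (F : Measure ℝ) (Iic x)ᶜ = 0 :=
      measure_mono_null (fun z hz hzJ => hz (h z hzJ)) hJc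
    rw [prob_compl_eq_zero_iff measurableSet_Iic] at h2
    rw [cdf_eq_real, measureReal_def, h2] at h1
    simp at h1
  obtain ⟨a, haJ, hax⟩ := hIcc
  obtain ⟨b, hbJ, hxb⟩ := hJu
  have hne : (Ioo x y ∩ J).Nonempty := by
    obtain ⟨c, hc1, hc2⟩ := exists_between (lt_min hxy hxb)
    exact ⟨c, ⟨hc1, hc2.trans_le (min_le_left _ _)⟩,
      hJ.out haJ hbJ ⟨hax.trans hc1.le, (hc2.trans_le (min_le_right _ _)).le⟩⟩
  have hpos := hF.2 _ isOpen_Ioo hne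
  have hIoc : 0 < (F : Measure ℝ) (Ioc x y) :=
    hpos.trans_le (measure_mono fun z hz => ⟨hz.1.1, hz.1.2.le⟩)
  rw [← measure_cdf (F : Measure ℝ), StieltjesFunction.measure_Ioc, ENNReal.ofReal_pos] at hIoc
  linarith

theorem isCrossing_quantile {F : ProbabilityMeasure ℝ} {J : Set ℝ} (hJ : J.OrdConnected)
    (hF : HasFullSupportOn (F : Measure ℝ) J) {v : ℝ} (hv : v ∈ Ioo (0 : ℝ) 1) :
    IsCrossing F v (quantile F v) := by
  refine ⟨fun y hy => (lt_quantile_iff F hv y).1 hy, fun y hy => ?_⟩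
  have h : v ≤ cdf (F : Measure ℝ) (quantile F v) := (quantile_le_iff F hv _).1 le_rfl
  rcases lt_or_ge (cdf (F : Measure ℝ) (quantile F v)) 1 with h1 | h1
  · exact h.trans_lt (cdf_lt_cdf_of_fullSupport hJ hF hy (hv.1.trans_le h) h1)
  · exact hv.2.trans_le (h1.trans (monotone_cdf _ hy.le))

/-- A `u`-quantile `x` of a distribution between the truncations of `F` is the crossing point of
some level between the bounds for `u`. -/
theorem exists_isCrossing_of_truncation {F : ProbabilityMeasure ℝ} {J : Set ℝ}
    (hJ : J.OrdConnected) (hF : HasFullSupportOn (F : Measure ℝ) J) {τ : ℝ}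
    (hτ : τ ∈ Ioo (0 : ℝ) 1) {u x : ℝ} (hu : u ∈ Ioo (0 : ℝ) 1)
    (hx : τ * u ≤ cdf (F : Measure ℝ) x)
    (hlt : ∀ y < x, cdf (F : Measure ℝ) y ≤ τ + (1 - τ) * u) :
    ∃ v, τ * u ≤ v ∧ v ≤ τ + (1 - τ) * u ∧ IsCrossing F v x := by
  have hmono := monotone_cdf (F : Measure ℝ)
  have hτu : 0 < τ * u := mul_pos hτ.1 hu.1
  have h1 : τ + (1 - τ) * u < 1 := by nlinarith [hτ.2, hu.2]
  have hL : Function.leftLim (cdf (F : Measure ℝ)) x ≤ τ + (1 - τ) * u :=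
    le_of_tendsto (hmono.tendsto_leftLim x) (by
      filter_upwards [self_mem_nhdsWithin] with y hy using hlt y hy)
  have hb : τ * u ≤ τ + (1 - τ) * u := by nlinarith [hτ.2, hu.2, hτ.1, hu.1]
  -- The levels crossed at `x` run from the left limit of the CDF to its value. This range meets `[τ
  -- u, τ + (1 - τ) u]`, and the maximum is the smallest common level. The term `τ u > 0` covers the
  -- `y` left of the support, where the CDF is 0 and need not increase.
  refine ⟨max (τ * u) (Function.leftLim (cdf (F : Measure ℝ)) x), le_max_left _ _,
    max_le hb hL, fun y hy => ?_, fun y hy => ?_⟩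
  · rcases (cdf_nonneg (F : Measure ℝ) y).eq_or_lt with h0 | h0
    · rw [← h0]
      exact hτu.trans_le (le_max_left _ _)
    · obtain ⟨z, hz1, hz2⟩ := exists_between hy
      refine lt_max_of_lt_right ((cdf_lt_cdf_of_fullSupport hJ hF hz1 h0 ?_).trans_le
        (hmono.le_leftLim hz2))
      exact (hlt y hy).trans_lt h1
  · have hmax : max (τ * u) (Function.leftLim (cdf (F : Measure ℝ)) x) ≤ cdf (F : Measure ℝ) x :=
      max_le hx (hmono.leftLim_le le_rfl)
    rcases lt_or_ge (cdf (F : Measure ℝ) x) 1 with h | h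
    · exact hmax.trans_lt (cdf_lt_cdf_of_fullSupport hJ hF hy (hτu.trans_le hx) h)
    · exact (max_le hb hL).trans_lt (h1.trans_le (h.trans (hmono hy.le)))

/-! ### Posteriors designed in level space -/

theorem exists_probabilityMeasure_cdf_eq_comp (F : ProbabilityMeasure ℝ) {Φ : ℝ → ℝ}
    (hc : Continuous Φ) (hm : MonotoneOn Φ (Icc 0 1)) (h0 : Φ 0 = 0) (h1 : Φ 1 = 1) :
    ∃ G : ProbabilityMeasure ℝ, ∀ x, cdf (G : Measure ℝ) x = Φ (cdf (F : Measure ℝ) x) := by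
  let S : StieltjesFunction ℝ :=
    { toFun := fun x => Φ (cdf (F : Measure ℝ) x)
      mono' := fun x y hxy => hm ⟨cdf_nonneg _ _, cdf_le_one _ _⟩ ⟨cdf_nonneg _ _, cdf_le_one _ _⟩
        (monotone_cdf _ hxy)
      right_continuous' := fun x =>
        hc.continuousAt.comp_continuousWithinAt ((cdf (F : Measure ℝ)).right_continuous x) }
  have hb : Tendsto S atBot (𝓝 0) := by
    have := (hc.tendsto 0).comp (tendsto_cdf_atBot (F : Measure ℝ))
    rwa [h0] at this
  have ht : Tendsto S atTop (𝓝 1) := by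
    have := (hc.tendsto 1).comp (tendsto_cdf_atTop (F : Measure ℝ))
    rwa [h1] at this
  refine ⟨⟨S.measure, S.isProbabilityMeasure hb ht⟩, fun x => ?_⟩
  exact congrArg (fun f : StieltjesFunction ℝ => f x) (cdf_measure_stieltjesFunction S hb ht)

/-- A decomposition of the prior into posteriors with unique `τ`-quantiles `x i`, given through
their CDFs as functions of the CDF of the prior, bounds the concave closure from below. -/
theorem sum_le_concaveClosure {F : ProbabilityMeasure ℝ} {τ : ℝ} (hτ : τ ∈ Ioo (0 : ℝ) 1)
    {r : Kernel (ProbabilityMeasure ℝ) ℝ} (hr : IsQuantileSelectionRule τ r) {f : ℝ → ℝ}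
    {w : ProbabilityMeasure ℝ → ℝ} (hw : ∀ G, w G = ∫ x, f x ∂(r G))
    {ι : Type*} [Fintype ι] {Φ : ι → ℝ → ℝ} (hc : ∀ i, Continuous (Φ i))
    (hm : ∀ i, StrictMonoOn (Φ i) (Icc 0 1)) (h0 : ∀ i, Φ i 0 = 0) {v x : ι → ℝ}
    (hv : ∀ i, v i ∈ Ioo (0 : ℝ) 1) (hΦ : ∀ i, Φ i (v i) = τ * Φ i 1)
    (hx : ∀ i, IsCrossing F (v i) (x i)) (hsum : ∀ p ∈ Icc (0 : ℝ) 1, ∑ i, Φ i p = p) :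
    ((∑ i, Φ i 1 * f (x i) : ℝ) : EReal) ≤ concaveClosure w F := by
  have hpos : ∀ i, 0 < Φ i 1 := fun i => by
    have := hm i (left_mem_Icc.2 zero_le_one) (right_mem_Icc.2 zero_le_one) zero_lt_one
    rwa [h0] at this
  have hG : ∀ i, ∃ G : ProbabilityMeasure ℝ, ∀ y,
      cdf (G : Measure ℝ) y = Φ i (cdf (F : Measure ℝ) y) / Φ i 1 := fun i =>
    exists_probabilityMeasure_cdf_eq_comp F (Φ := fun p => Φ i p / Φ i 1)
      ((hc i).div_const _) (fun p hp q hq hpq =>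
        div_le_div_of_nonneg_right ((hm i).monotoneOn hp hq hpq) (hpos i).le)
      (by simp [h0]) (div_self (hpos i).ne')
  choose G hG using hG
  have hF : ∀ y, cdf (F : Measure ℝ) y ∈ Icc (0 : ℝ) 1 := fun y => ⟨cdf_nonneg _ _, cdf_le_one _ _⟩
  have hwG : ∀ i, w (G i) = f (x i) := fun i => by
    rw [hw]
    refine hr.integral_eq (quantileSet_subset_singleton (G i) hτ (fun y hy => ?_) fun y hy => ?_) f
    · rw [hG, div_lt_iff₀ (hpos i), ← hΦ]
      exact hm i (hF y) (Ioo_subset_Icc_self (hv i)) ((hx i).1 y hy)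
    · rw [hG, lt_div_iff₀ (hpos i), ← hΦ]
      exact hm i (Ioo_subset_Icc_self (hv i)) (hF y) ((hx i).2 y hy)
  have hmem := (convex_convexHull ℝ (range fun G : ProbabilityMeasure ℝ =>
      ((cdf (G : Measure ℝ) : ℝ → ℝ), w G))).sum_mem (t := Finset.univ) (w := fun i => Φ i 1)
    (z := fun i => ((cdf (G i : Measure ℝ) : ℝ → ℝ), w (G i))) (fun i _ => (hpos i).le)
    (hsum 1 (right_mem_Icc.2 zero_le_one)) (fun i _ => subset_convexHull _ _ (mem_range_self _))
  have heq : ∑ i, Φ i 1 • ((cdf (G i : Measure ℝ) : ℝ → ℝ), w (G i)) =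
      ((cdf (F : Measure ℝ) : ℝ → ℝ), ∑ i, Φ i 1 * f (x i)) := by
    refine Prod.ext ?_ ?_
    · rw [Prod.fst_sum]
      funext y
      rw [Finset.sum_apply]
      refine (Finset.sum_congr rfl fun i _ => ?_).trans (hsum _ (hF y))
      simp [hG, mul_div_cancel₀ _ (hpos i).ne']
    · rw [Prod.snd_sum]
      exact Finset.sum_congr rfl fun i _ => by simp [hwG]
  rw [heq] at hmem
  exact le_iSup₂ (f := fun (z : ℝ) (_ : ((cdf (F : Measure ℝ) : ℝ → ℝ), z) ∈ _) => (z : EReal)) _ hmem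

/-! ### Perturbation to posteriors with unique quantiles -/

/-- The cumulative function of the density that spreads mass `τ` uniformly over `(0, v)` and mass
`1 - τ` uniformly over `(v, 1)`. -/
noncomputable def tilt (τ v p : ℝ) : ℝ := τ / v * min p v + (1 - τ) / (1 - v) * max (p - v) 0

theorem min_add_max_sub (p v : ℝ) : min p v + max (p - v) 0 = p := by
  rcases le_total p v with h | h
  · rw [min_eq_left h, max_eq_right (by linarith)]; ring
  · rw [min_eq_right h, max_eq_left (by linarith)]; ring

theorem continuous_tilt (τ v : ℝ) : Continuous (tilt τ v) := by
  unfold tilt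
  fun_prop

theorem tilt_zero {τ v : ℝ} (hv : v ∈ Ioo (0 : ℝ) 1) : tilt τ v 0 = 0 := by
  rw [tilt, min_eq_left hv.1.le, max_eq_right (by linarith [hv.1])]
  ring

theorem tilt_self {τ v : ℝ} (hv : v ∈ Ioo (0 : ℝ) 1) : tilt τ v v = τ := by
  rw [tilt, min_self, sub_self, max_self, mul_zero, add_zero, div_mul_cancel₀ _ hv.1.ne']

theorem tilt_one {τ v : ℝ} (hv : v ∈ Ioo (0 : ℝ) 1) : tilt τ v 1 = 1 := by
  have h : 0 < 1 - v := sub_pos.2 hv.2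
  rw [tilt, min_eq_right hv.2.le, max_eq_left h.le, div_mul_cancel₀ _ hv.1.ne',
    div_mul_cancel₀ _ h.ne']
  ring

theorem strictMono_tilt {τ v : ℝ} (hτ : τ ∈ Ioo (0 : ℝ) 1) (hv : v ∈ Ioo (0 : ℝ) 1) :
    StrictMono (tilt τ v) := by
  intro p q hpq
  have hA : 0 < τ / v := div_pos hτ.1 hv.1
  have hB : 0 < (1 - τ) / (1 - v) := div_pos (sub_pos.2 hτ.2) (sub_pos.2 hv.2)
  have h1 : min p v ≤ min q v := min_le_min_right _ hpq.le
  have h2 : max (p - v) 0 ≤ max (q - v) 0 := max_le_max_right _ (by linarith)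
  have hp := min_add_max_sub p v
  have hq := min_add_max_sub q v
  unfold tilt
  rcases h1.eq_or_lt with h | h
  · have : max (p - v) 0 < max (q - v) 0 := by linarith
    rw [h]
    gcongr
  · exact add_lt_add_of_lt_of_le (mul_lt_mul_of_pos_left h hA) (mul_le_mul_of_nonneg_left h2 hB.le)

theorem tilt_sub_le {τ v : ℝ} (hτ : τ ∈ Ioo (0 : ℝ) 1) (hv : v ∈ Ioo (0 : ℝ) 1) {p q : ℝ}
    (hpq : p ≤ q) : tilt τ v q - tilt τ v p ≤ (τ / v + (1 - τ) / (1 - v)) * (q - p) := by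
  have hA : 0 < τ / v := div_pos hτ.1 hv.1
  have hB : 0 < (1 - τ) / (1 - v) := div_pos (sub_pos.2 hτ.2) (sub_pos.2 hv.2)
  have h1 : min p v ≤ min q v := min_le_min_right _ hpq
  have h2 : max (p - v) 0 ≤ max (q - v) 0 := max_le_max_right _ (by linarith)
  have hp := min_add_max_sub p v
  have hq := min_add_max_sub q v
  have h3 := mul_le_mul_of_nonneg_left (show min q v - min p v ≤ q - p by linarith) hA.le
  have h4 := mul_le_mul_of_nonneg_left
    (show max (q - v) 0 - max (p - v) 0 ≤ q - p by linarith) hB.le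
  unfold tilt
  linarith

/-- Rescale the increments of `ψ` by `a` before `z` and by `b` after `z`. -/
def rescale (ψ : ℝ → ℝ) (z a b p : ℝ) : ℝ := a * ψ (min p z) + b * (ψ (max p z) - ψ z)

theorem Continuous.rescale {ψ : ℝ → ℝ} (hψ : Continuous ψ) (z a b : ℝ) :
    Continuous (rescale ψ z a b) := by
  unfold _root_.rescale
  fun_prop

theorem rescale_of_le {ψ : ℝ → ℝ} {z a b p : ℝ} (h : p ≤ z) : rescale ψ z a b p = a * ψ p := by
  rw [rescale, min_eq_left h, max_eq_right h]
  ring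

theorem rescale_of_ge {ψ : ℝ → ℝ} {z a b p : ℝ} (h : z ≤ p) :
    rescale ψ z a b p = a * ψ z + b * (ψ p - ψ z) := by
  rw [rescale, min_eq_right h, max_eq_left h]

theorem rescale_add_rescale (ψ : ℝ → ℝ) (z a b p : ℝ) :
    rescale ψ z a b p + rescale ψ z (1 - a) (1 - b) p = ψ p := by
  rcases le_total p z with h | h
  · rw [rescale_of_le h, rescale_of_le h]; ring
  · rw [rescale_of_ge h, rescale_of_ge h]; ring

theorem StrictMonoOn.rescale {ψ : ℝ → ℝ} (hψ : StrictMonoOn ψ (Icc 0 1)) {z a b : ℝ}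
    (hz : z ∈ Icc (0 : ℝ) 1) (ha : 0 < a) (hb : 0 < b) :
    StrictMonoOn (rescale ψ z a b) (Icc 0 1) := by
  intro p hp q hq hpq
  rcases le_total q z with h | h
  · rw [rescale_of_le h, rescale_of_le (hpq.le.trans h)]
    exact mul_lt_mul_of_pos_left (hψ hp hq hpq) ha
  rcases le_or_gt z p with h' | h'
  · rw [rescale_of_ge h, rescale_of_ge h']
    have := mul_lt_mul_of_pos_left (hψ hp hq hpq) hb
    linarith
  · rw [rescale_of_ge h, rescale_of_le h'.le]
    have h1 := mul_lt_mul_of_pos_left (hψ hp hz h') ha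
    have h2 := mul_nonneg hb.le (sub_nonneg.2 (hψ.monotoneOn hz hq h))
    linarith

/-- A cumulative function close to the identity splits into two parts whose unique `τ`-quantiles
are the levels `τ - s` and `τ + s`. -/
theorem exists_split_of_near_id {τ s : ℝ} (hs : 0 < s) (hsτ : 4 * s ≤ τ) (hsτ' : 4 * s ≤ 1 - τ)
    {ψ : ℝ → ℝ} (hc : Continuous ψ) (hm : StrictMonoOn ψ (Icc 0 1)) (h0 : ψ 0 = 0)
    (hψ : ∀ p ∈ Icc (0 : ℝ) 1, |ψ p - p| ≤ s / 100) :
    ∃ φ₁ φ₂ : ℝ → ℝ, Continuous φ₁ ∧ Continuous φ₂ ∧ StrictMonoOn φ₁ (Icc 0 1) ∧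
      StrictMonoOn φ₂ (Icc 0 1) ∧ φ₁ 0 = 0 ∧ φ₂ 0 = 0 ∧ φ₁ (τ - s) = τ * φ₁ 1 ∧
      φ₂ (τ + s) = τ * φ₂ 1 ∧ ∀ p, φ₁ p + φ₂ p = ψ p := by
  have hz : τ - s ∈ Icc (0 : ℝ) 1 := ⟨by linarith, by linarith⟩
  obtain ⟨h1l, h1u⟩ := abs_le.1 (hψ (τ - s) hz)
  obtain ⟨h2l, h2u⟩ := abs_le.1 (hψ (τ + s) ⟨by linarith, by linarith⟩)
  obtain ⟨h3l, h3u⟩ := abs_le.1 (hψ 1 ⟨by linarith, by linarith⟩)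
  have hτ0 : 0 < τ := by linarith
  have hτ1 : 0 < 1 - τ := by linarith
  set A := ψ (τ - s)
  set B := ψ (τ + s)
  set C := ψ 1
  have hA : 0 < A := by linarith
  have hBA : 0 < B - A := by linarith
  have hτC : |τ * C - τ| ≤ s / 100 := by
    rw [show τ * C - τ = τ * (C - 1) by ring, abs_mul, abs_of_pos hτ0]
    have : |C - 1| ≤ s / 100 := abs_le.2 ⟨h3l, h3u⟩
    nlinarith [abs_nonneg (C - 1)]
  obtain ⟨h4l, h4u⟩ := abs_le.1 hτC
  -- `b` and `a` solve the two quantile equations: adding them gives `B - b (B - A) = τ C`, and the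
  -- first alone then gives `a`. For `ψ = id` one gets `b = 1/2` and `a ≤ 5/6`. The tolerance `s /
  -- 100` keeps both below 1.
  set b := (B - τ * C) / (B - A) with hb
  have hb0 : 0 < b := div_pos (by linarith) hBA
  have hb1 : b < 52 / 100 := by
    rw [hb, div_lt_iff₀ hBA]
    linarith
  set a := τ * b * (C - A) / ((1 - τ) * A) with ha
  have hCA : 0 < C - A := by linarith
  have ha0 : 0 < a := by positivity
  have ha1 : a < 1 := by
    rw [ha, div_lt_one (by positivity)]
    have e1 : C - A ≤ 126 / 100 * (1 - τ) := by linarith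
    have e2 : 74 / 100 * τ ≤ A := by linarith
    calc τ * b * (C - A) ≤ τ * (52 / 100) * (126 / 100 * (1 - τ)) := by gcongr
      _ < (1 - τ) * (74 / 100 * τ) := by nlinarith [mul_pos hτ0 hτ1]
      _ ≤ (1 - τ) * A := by gcongr
  have haA : (1 - τ) * (a * A) = τ * b * (C - A) := by
    rw [ha]
    field_simp
  have hbBA : b * (B - A) = B - τ * C := div_mul_cancel₀ _ hBA.ne'
  refine ⟨rescale ψ (τ - s) a b, rescale ψ (τ - s) (1 - a) (1 - b), hc.rescale _ _ _,
    hc.rescale _ _ _, hm.rescale hz ha0 hb0, hm.rescale hz (by linarith) (by linarith), ?_, ?_, ?_,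
    ?_, rescale_add_rescale _ _ _ _⟩
  · rw [rescale_of_le hz.1, h0, mul_zero]
  · rw [rescale_of_le hz.1, h0, mul_zero]
  · rw [rescale_of_le le_rfl, rescale_of_ge hz.2]
    change a * A = τ * (a * A + b * (C - A))
    linarith
  · rw [rescale_of_ge (by linarith), rescale_of_ge hz.2]
    change (1 - a) * A + (1 - b) * (B - A) = τ * ((1 - a) * A + (1 - b) * (C - A))
    linarith

/-- As `sum_le_concaveClosure`, but the posteriors need not have unique `τ`-quantiles. -/
theorem sum_le_concaveClosure_of_monotoneOn {F : ProbabilityMeasure ℝ} {J : Set ℝ}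
    (hJ : J.OrdConnected) (hF : HasFullSupportOn (F : Measure ℝ) J) {τ : ℝ}
    (hτ : τ ∈ Ioo (0 : ℝ) 1)
    {r : Kernel (ProbabilityMeasure ℝ) ℝ} (hr : IsQuantileSelectionRule τ r) {f : ℝ → ℝ}
    {w : ProbabilityMeasure ℝ → ℝ} (hw : ∀ G, w G = ∫ x, f x ∂(r G))
    {ι : Type*} [Fintype ι] {Φ : ι → ℝ → ℝ} (hc : ∀ i, Continuous (Φ i))
    (hm : ∀ i, MonotoneOn (Φ i) (Icc 0 1)) (h0 : ∀ i, Φ i 0 = 0) (h1 : ∀ i, 0 < Φ i 1)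
    {v x : ι → ℝ} (hv : ∀ i, v i ∈ Ioo (0 : ℝ) 1) (hΦ : ∀ i, Φ i (v i) = τ * Φ i 1)
    (hx : ∀ i, IsCrossing F (v i) (x i)) (hsum : ∀ p ∈ Icc (0 : ℝ) 1, ∑ i, Φ i p = p) :
    ((∑ i, Φ i 1 * f (x i) : ℝ) : EReal) ≤ concaveClosure w F := by
  have hsum1 : ∑ i, Φ i 1 = 1 := hsum 1 (right_mem_Icc.2 zero_le_one)
  obtain ⟨s, hs, hsτ, hsτ'⟩ : ∃ s : ℝ, 0 < s ∧ 4 * s ≤ τ ∧ 4 * s ≤ 1 - τ := by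
    refine ⟨min τ (1 - τ) / 4, by have := lt_min hτ.1 (sub_pos.2 hτ.2); positivity, ?_, ?_⟩
    · linarith [min_le_left τ (1 - τ)]
    · linarith [min_le_right τ (1 - τ)]
  set C := ∑ i, Φ i 1 * (τ / v i + (1 - τ) / (1 - v i)) with hC
  have hC0 : 0 ≤ C := Finset.sum_nonneg fun i _ => mul_nonneg (h1 i).le
    (add_nonneg (div_nonneg hτ.1.le (hv i).1.le)
      (div_nonneg (sub_pos.2 hτ.2).le (sub_pos.2 (hv i).2).le))
  -- `θ ≤ s / 100` keeps `ψ` close enough to the identity to be split. `θ * C < 1`, with `C` a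
  -- Lipschitz bound for `D`, keeps it strictly increasing.
  obtain ⟨θ, hθ, hθs, hθC⟩ : ∃ θ : ℝ, 0 < θ ∧ θ ≤ s / 100 ∧ θ * C < 1 := by
    refine ⟨min (s / 100) (1 / (C + 1)), lt_min (by positivity) (by positivity),
      min_le_left _ _, ?_⟩
    calc min (s / 100) (1 / (C + 1)) * C ≤ 1 / (C + 1) * C := by gcongr; exact min_le_right _ _
      _ < 1 := by rw [one_div_mul_eq_div, div_lt_one (by linarith)]; linarith
  set D : ℝ → ℝ := fun p => ∑ i, Φ i 1 * tilt τ (v i) p with hD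
  set ψ : ℝ → ℝ := fun p => p - θ * D p with hψdef
  have hDc : Continuous D := continuous_finsetSum _ fun i _ =>
    continuous_const.mul (continuous_tilt τ (v i))
  have hψc : Continuous ψ := continuous_id.sub (continuous_const.mul hDc)
  have hDlip : ∀ p q : ℝ, p ≤ q → D q - D p ≤ C * (q - p) := fun p q hpq => by
    rw [hD, hC, ← Finset.sum_sub_distrib, Finset.sum_mul]
    refine Finset.sum_le_sum fun i _ => ?_
    rw [← mul_sub, mul_assoc]
    exact mul_le_mul_of_nonneg_left (tilt_sub_le hτ (hv i) hpq) (h1 i).le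
  have hψm : StrictMono ψ := fun p q hpq => by
    have e1 := mul_le_mul_of_nonneg_left (hDlip p q hpq.le) hθ.le
    have e2 := mul_lt_mul_of_pos_right hθC (sub_pos.2 hpq)
    simp only [hψdef]
    linarith
  have hDmono : Monotone D := fun p q hpq => Finset.sum_le_sum fun i _ =>
    mul_le_mul_of_nonneg_left ((strictMono_tilt hτ (hv i)).monotone hpq) (h1 i).le
  have hD0 : D 0 = 0 := Finset.sum_eq_zero fun i _ => by rw [tilt_zero (hv i), mul_zero]
  have hD1 : D 1 = 1 := by
    refine Eq.trans ?_ hsum1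
    exact Finset.sum_congr rfl fun i _ => by rw [tilt_one (hv i), mul_one]
  obtain ⟨φ₁, φ₂, c₁, c₂, m₁, m₂, z₁, z₂, q₁, q₂, hφ⟩ := exists_split_of_near_id hs hsτ hsτ' hψc
    (hψm.strictMonoOn _) (by simp [hψdef, hD0]) (fun p hp => by
      have e1 := hDmono hp.1
      have e2 := hDmono hp.2
      rw [hD0] at e1
      rw [hD1] at e2
      rw [hψdef, show p - θ * D p - p = -(θ * D p) by ring, abs_neg, abs_of_nonneg (by positivity)]
      nlinarith)
  have hz₁ : τ - s ∈ Ioo (0 : ℝ) 1 := ⟨by linarith [hτ.1], by linarith [hτ.2]⟩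
  have hz₂ : τ + s ∈ Ioo (0 : ℝ) 1 := ⟨by linarith [hτ.1], by linarith [hτ.2, hτ.1]⟩
  set S := ∑ i, Φ i 1 * f (x i) with hS
  have key : ∀ κ ∈ Ioo (0 : ℝ) 1, (((1 - κ + κ * θ) * S + κ * (φ₁ 1 * f (quantile F (τ - s)) +
      φ₂ 1 * f (quantile F (τ + s))) : ℝ) : EReal) ≤ concaveClosure w F := by
    intro κ hκ
    have hκ' : 0 < 1 - κ := sub_pos.2 hκ.2
    -- A fraction `κ` of the prior is set aside. Of it, `θ D` goes to tilts that make each `Φ i`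
    -- strictly increasing without moving its quantile level, and the remainder `ψ` forms the two
    -- extra posteriors.
    have := sum_le_concaveClosure hτ hr hw (F := F) (ι := ι ⊕ Bool)
      (Φ := Sum.elim (fun i p => (1 - κ) * Φ i p + κ * θ * (Φ i 1 * tilt τ (v i) p))
        (fun j p => κ * (if j then φ₁ p else φ₂ p)))
      (v := Sum.elim v fun j => if j then τ - s else τ + s)
      (x := Sum.elim x fun j => if j then quantile F (τ - s) else quantile F (τ + s))
      ?_ ?_ ?_ ?_ ?_ ?_ ?_
    · convert this using 2
      rw [Fintype.sum_sum_type, Fintype.sum_bool]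
      simp only [Sum.elim_inl, Sum.elim_inr, if_true, Bool.false_eq_true, if_false]
      have : ∀ i, ((1 - κ) * Φ i 1 + κ * θ * (Φ i 1 * tilt τ (v i) 1)) * f (x i) =
          (1 - κ + κ * θ) * (Φ i 1 * f (x i)) := fun i => by rw [tilt_one (hv i)]; ring
      rw [Finset.sum_congr rfl fun i _ => this i, ← Finset.mul_sum, ← hS]
      ring
    · rintro (i | _ | _)
      · exact (continuous_const.mul (hc i)).add
          (continuous_const.mul (continuous_const.mul (continuous_tilt _ _)))
      · exact continuous_const.mul c₂
      · exact continuous_const.mul c₁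
    · rintro (i | _ | _) p hp q hq hpq
      · exact add_lt_add_of_le_of_lt (mul_le_mul_of_nonneg_left (hm i hp hq hpq.le) hκ'.le)
          (mul_lt_mul_of_pos_left (mul_lt_mul_of_pos_left (strictMono_tilt hτ (hv i) hpq) (h1 i))
            (mul_pos hκ.1 hθ))
      · exact mul_lt_mul_of_pos_left (m₂ hp hq hpq) hκ.1
      · exact mul_lt_mul_of_pos_left (m₁ hp hq hpq) hκ.1
    · rintro (i | _ | _)
      · simp [h0, tilt_zero (hv i)]
      · simp [z₂]
      · simp [z₁]
    · rintro (i | _ | _)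
      · exact hv i
      · exact hz₂
      · exact hz₁
    · rintro (i | _ | _)
      · simp only [Sum.elim_inl, tilt_self (hv i), tilt_one (hv i), hΦ]
        ring
      · simp only [Sum.elim_inr, Bool.false_eq_true, if_false, q₂]
        ring
      · simp only [Sum.elim_inr, if_true, q₁]
        ring
    · rintro (i | _ | _)
      · exact hx i
      · exact isCrossing_quantile hJ hF hz₂
      · exact isCrossing_quantile hJ hF hz₁
    · intro p hp
      rw [Fintype.sum_sum_type, Fintype.sum_bool]
      simp only [Sum.elim_inl, Sum.elim_inr, if_true, Bool.false_eq_true, if_false]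
      rw [Finset.sum_add_distrib, ← Finset.mul_sum, ← Finset.mul_sum, hsum p hp, ← mul_add, hφ]
      simp only [hψdef, hD]
      ring
  -- `θ`, `φ₁` and `φ₂` do not depend on `κ`, so the extra terms vanish as `κ → 0`.
  have hlim : Tendsto (fun κ : ℝ => (1 - κ + κ * θ) * S + κ * (φ₁ 1 * f (quantile F (τ - s)) +
      φ₂ 1 * f (quantile F (τ + s)))) (𝓝[>] 0) (𝓝 S) := by
    have : Continuous (fun κ : ℝ => (1 - κ + κ * θ) * S + κ * (φ₁ 1 * f (quantile F (τ - s)) +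
      φ₂ 1 * f (quantile F (τ + s)))) := by fun_prop
    have h := (this.tendsto 0).mono_left (nhdsWithin_le_nhds (s := Ioi 0))
    simpa using h
  refine le_of_tendsto ((continuous_coe_real_ereal.tendsto S).comp hlim) ?_
  filter_upwards [Ioo_mem_nhdsGT zero_lt_one] with κ hκ using key κ hκ

/-! ### Slicing the prior and Riemann sums -/

/-- The length of the part of the interval `(a, b)` that lies below `p`. -/
noncomputable def chunk (a b p : ℝ) : ℝ := max a (min p b) - a

theorem continuous_chunk (a b : ℝ) : Continuous (chunk a b) := by
  unfold chunk
  fun_prop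

theorem monotone_chunk (a b : ℝ) : Monotone (chunk a b) := fun _ _ h =>
  sub_le_sub_right (max_le_max_left _ (min_le_min_right _ h)) _

theorem chunk_of_le {a b p : ℝ} (h : p ≤ a) : chunk a b p = 0 := by
  rw [chunk, max_eq_left ((min_le_left _ _).trans h), sub_self]

theorem chunk_of_ge {a b p : ℝ} (hab : a ≤ b) (h : b ≤ p) : chunk a b p = b - a := by
  rw [chunk, min_eq_right h, max_eq_right hab]

theorem chunk_of_mem {a b p : ℝ} (ha : a ≤ p) (hb : p ≤ b) : chunk a b p = p - a := by
  rw [chunk, min_eq_left hb, max_eq_right ha]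

theorem chunk_add_chunk {a b c : ℝ} (hab : a ≤ b) (hbc : b ≤ c) (p : ℝ) :
    chunk a b p + chunk b c p = chunk a c p := by
  rcases le_total p b with h | h
  · rw [chunk_of_le h, add_zero, chunk, chunk, min_eq_left h, min_eq_left (h.trans hbc)]
  · rw [chunk_of_ge hab h, chunk, chunk, max_eq_right (le_min h hbc),
      max_eq_right (hab.trans (le_min h hbc))]
    ring

theorem sum_chunk {s : ℕ → ℝ} (hs : Monotone s) (N : ℕ) (p : ℝ) :
    ∑ j ∈ Finset.range N, chunk (s j) (s (j + 1)) p = chunk (s 0) (s N) p := by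
  induction N with
  | zero => simp [chunk]
  | succ N ih =>
    rw [Finset.sum_range_succ, ih, chunk_add_chunk (hs N.zero_le) (hs N.le_succ)]

/-- Of the `N + 2` cells of `[0, 1]` the first and last are sacrificed. This keeps the sample points
inside `(0, 1)` and leaves room to shift the upper slices. The leftover mass `2 / (N + 2)` forms one
posterior with quantile level `τ`. -/
theorem riemann_sum_le_concaveClosure {F : ProbabilityMeasure ℝ} {J : Set ℝ}
    (hJ : J.OrdConnected) (hF : HasFullSupportOn (F : Measure ℝ) J) {τ : ℝ}
    (hτ : τ ∈ Ioo (0 : ℝ) 1)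
    {r : Kernel (ProbabilityMeasure ℝ) ℝ} (hr : IsQuantileSelectionRule τ r) {f : ℝ → ℝ}
    {w : ProbabilityMeasure ℝ → ℝ} (hw : ∀ G, w G = ∫ x, f x ∂(r G)) {X : ℝ → ℝ}
    (hX : ∀ u ∈ Ioo (0 : ℝ) 1, ∃ v, τ * u ≤ v ∧ v ≤ τ + (1 - τ) * u ∧ IsCrossing F v (X u))
    (N : ℕ) {t : ℝ} (ht : t ∈ Icc (0 : ℝ) 1) :
    ((2 / (N + 2) * f (quantile F τ) +
      ∑ j ∈ Finset.range N, 1 / (N + 2) * f (X ((j + 1 + t) / (N + 2))) : ℝ) : EReal) ≤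
      concaveClosure w F := by
  have hn : (0 : ℝ) < N + 2 := by positivity
  have hτ1 : 0 < 1 - τ := sub_pos.2 hτ.2
  have hu : ∀ j : Fin N, ((j : ℝ) + 1 + t) / (N + 2) ∈ Ioo (0 : ℝ) 1 := fun j => by
    have hj : (j : ℝ) + 1 ≤ N := by exact_mod_cast j.2
    have hj0 : (0 : ℝ) ≤ j := Nat.cast_nonneg _
    exact ⟨div_pos (by linarith [ht.1]) hn, (div_lt_one hn).2 (by linarith [ht.2])⟩
  choose v hvl hvu hvx using fun j : Fin N => hX _ (hu j)
  set L : ℕ → ℝ := fun j => τ * (j / (N + 2)) with hL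
  set R : ℕ → ℝ := fun j => τ + (1 - τ) * (j / (N + 2)) with hR
  have hLm : Monotone L := fun i j hij => by
    have : (i : ℝ) ≤ j := by exact_mod_cast hij
    exact mul_le_mul_of_nonneg_left (div_le_div_of_nonneg_right this hn.le) hτ.1.le
  have hRm : Monotone R := fun i j hij => by
    have : (i : ℝ) ≤ j := by exact_mod_cast hij
    exact add_le_add_right (mul_le_mul_of_nonneg_left (div_le_div_of_nonneg_right this hn.le) hτ1.le) _
  have hLτ : L N ≤ τ := by
    have : (N : ℝ) / (N + 2) ≤ 1 := (div_le_one hn).2 (by linarith)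
    exact (mul_le_mul_of_nonneg_left this hτ.1.le).trans_eq (mul_one _)
  have hτR : ∀ j, τ ≤ R j := fun j => le_add_of_nonneg_right (by positivity)
  have hL0 : L 0 = 0 := by simp [hL]
  have hRn : R (N + 2) = 1 := by
    simp only [hR, Nat.cast_add, Nat.cast_ofNat, div_self hn.ne']
    ring
  have hLd : ∀ j, L (j + 1) - L j = τ * (1 / (N + 2)) := fun j => by
    simp only [hL, Nat.cast_add, Nat.cast_one]
    ring
  have hRd : ∀ j, R (j + 1) - R j = (1 - τ) * (1 / (N + 2)) := fun j => by
    simp only [hR, Nat.cast_add, Nat.cast_one]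
    ring
  have hRL : R 2 - L N = 2 / (N + 2) := by
    simp only [hR, hL, Nat.cast_ofNat]
    field_simp
    ring
  have hτL : τ - L N = τ * (2 / (N + 2)) := by
    simp only [hL]
    field_simp
    ring
  have hR1 : ∀ j : Fin N, R (j + 3) ≤ 1 := fun j => by
    rw [← hRn]
    exact hRm (by omega)
  have hL1 : ∀ j : Fin N, L (j + 1) ≤ v j := fun j => by
    refine le_trans (mul_le_mul_of_nonneg_left ?_ hτ.1.le) (hvl j)
    push_cast
    exact div_le_div_of_nonneg_right (by linarith [ht.1]) hn.le
  have hR2 : ∀ j : Fin N, v j ≤ R (j + 2) := fun j => by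
    refine (hvu j).trans (add_le_add_right (mul_le_mul_of_nonneg_left ?_ hτ1.le) _)
    push_cast
    exact div_le_div_of_nonneg_right (by linarith [ht.2]) hn.le
  have hv : ∀ j, v j ∈ Ioo (0 : ℝ) 1 := fun j =>
    ⟨(mul_pos hτ.1 (hu j).1).trans_le (hvl j), (hvu j).trans_lt (by nlinarith [(hu j).2])⟩
  -- The sample point of posterior `j` lies in cell `j + 1`, so its level is only known to lie in
  -- `[L (j + 1), R (j + 2)]`. The lower slice ends at `L (j + 1)` and the upper one starts at `R (j
  -- + 2)`, so they lie on opposite sides of it. The hole `(L N, R 2)` goes to `none`.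
  set Φ : Option (Fin N) → ℝ → ℝ := fun i => i.elim (chunk (L N) (R 2))
    (fun j p => chunk (L j) (L (j + 1)) p + chunk (R (j + 2)) (R (j + 3)) p) with hΦ
  have hΦ1 : ∀ j : Fin N, Φ (some j) 1 = 1 / (N + 2) := fun j => by
    change chunk (L j) (L (j + 1)) 1 + chunk (R (j + 2)) (R (j + 3)) 1 = _
    rw [chunk_of_ge (hLm (Nat.le_succ _)) ((hL1 j).trans (hv j).2.le),
      chunk_of_ge (hRm (Nat.le_succ _)) (hR1 j), hLd, hRd]
    ring
  have hΦn : Φ none 1 = 2 / (N + 2) := by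
    change chunk (L N) (R 2) 1 = _
    rw [chunk_of_ge (hLτ.trans (hτR _)) (by rw [← hRn]; exact hRm (by omega)), hRL]
  have key := sum_le_concaveClosure_of_monotoneOn hJ hF hτ hr hw (Φ := Φ)
    (v := fun i => i.elim τ v)
    (x := fun i => i.elim (quantile F τ) fun j => X ((j + 1 + t) / (N + 2))) ?_ ?_ ?_ ?_ ?_ ?_ ?_ ?_
  · rw [Fintype.sum_option, hΦn] at key
    simp only [hΦ1, Option.elim_none, Option.elim_some] at key
    rwa [Finset.sum_range fun j : ℕ => 1 / ((N : ℝ) + 2) * f (X ((j + 1 + t) / (N + 2)))]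
  · rintro (_ | j)
    · exact continuous_chunk _ _
    · exact (continuous_chunk _ _).add (continuous_chunk _ _)
  · rintro (_ | j)
    · exact (monotone_chunk _ _).monotoneOn _
    · exact ((monotone_chunk _ _).add (monotone_chunk _ _)).monotoneOn _
  · have hL0' : ∀ j, 0 ≤ L j := fun j => by rw [← hL0]; exact hLm j.zero_le
    rintro (_ | j)
    · exact chunk_of_le (hL0' _)
    · change chunk _ _ 0 + chunk _ _ 0 = 0
      rw [chunk_of_le (hL0' _), chunk_of_le (hτ.1.le.trans (hτR _)), add_zero]
  · rintro (_ | j)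
    · rw [hΦn]; positivity
    · rw [hΦ1]; positivity
  · rintro (_ | j)
    · exact hτ
    · exact hv j
  · rintro (_ | j)
    · rw [hΦn]
      change chunk _ _ τ = _
      rw [chunk_of_mem hLτ (hτR 2), hτL]
    · rw [hΦ1]
      change chunk _ _ (v j) + chunk _ _ (v j) = _
      rw [chunk_of_ge (hLm (Nat.le_succ _)) (hL1 j), chunk_of_le (hR2 j), hLd, add_zero]
  · rintro (_ | j)
    · exact isCrossing_quantile hJ hF hτ
    · exact hvx j
  · intro p hp
    rw [Fintype.sum_option]
    change chunk (L N) (R 2) p + ∑ j : Fin N, (chunk (L j) (L (j + 1)) p +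
      chunk (R (j + 2)) (R (j + 3)) p) = p
    rw [← Finset.sum_range fun j : ℕ => chunk (L j) (L (j + 1)) p +
      chunk (R (j + 2)) (R (j + 3)) p, Finset.sum_add_distrib, sum_chunk hLm,
      sum_chunk (s := fun j => R (j + 2)) (fun i j hij => hRm (by omega)), ← add_assoc,
      add_comm (chunk (L N) (R 2) p), chunk_add_chunk (hLm N.zero_le) (hLτ.trans (hτR 2))]
    change chunk (L 0) (R (0 + 2)) p + chunk (R (0 + 2)) (R (N + 2)) p = p
    rw [chunk_add_chunk ((hLm N.zero_le).trans (hLτ.trans (hτR _))) (hRm (by omega)), hL0, hRn,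
      chunk_of_mem hp.1 hp.2, sub_zero]

/-- Some Riemann sum over `n` equally spaced points is at least the integral. -/
theorem exists_integral_le_riemann_sum {g : ℝ → ℝ} (hg : Measurable g) {K : ℝ}
    (hK : ∀ u, |g u| ≤ K) {n : ℕ} (hn : 0 < n) :
    ∃ t ∈ Icc (0 : ℝ) 1,
      ∫ u in (0 : ℝ)..1, g u ≤ ∑ k ∈ Finset.range n, 1 / (n : ℝ) * g ((k + t) / n) := by
  have hn' : (0 : ℝ) < n := Nat.cast_pos.2 hn
  have hint : ∀ (h : ℝ → ℝ) (_ : Measurable h) (a b : ℝ),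
      IntervalIntegrable (fun t => g (h t)) volume a b := fun h hh a b => by
    refine (intervalIntegrable_const (c := K)).mono_fun (hg.comp hh).aestronglyMeasurable ?_
    refine Eventually.of_forall fun t => ?_
    exact (hK _).trans (le_abs_self K)
  have hkint : ∀ k ∈ Finset.range n, IntervalIntegrable
      (fun t => 1 / (n : ℝ) * g ((k + t) / n)) volume 0 1 := fun k _ =>
    (hint (fun t => (k + t) / n) (by fun_prop) 0 1).const_mul _
  -- Averaging over the offset `t` turns the Riemann sum into the exact integral, so some offset
  -- does at least as well. This needs no regularity of `g` beyond measurability and boundedness.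
  have heq : ∫ t in (0 : ℝ)..1, ∑ k ∈ Finset.range n, 1 / (n : ℝ) * g ((k + t) / n) =
      ∫ u in (0 : ℝ)..1, g u := by
    rw [intervalIntegral.integral_finsetSum hkint]
    have h1 : ∀ k ∈ Finset.range n, ∫ t in (0 : ℝ)..1, 1 / (n : ℝ) * g ((k + t) / n) =
        ∫ u in ((fun k : ℕ => (k : ℝ) / n) k)..((fun k : ℕ => (k : ℝ) / n) (k + 1)), g u := by
      intro k _
      have h2 : ∀ t : ℝ, g ((k + t) / n) = g (k / n + t / n) := fun t => by rw [add_div]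
      simp_rw [h2]
      rw [intervalIntegral.integral_const_mul,
        intervalIntegral.integral_comp_add_div g hn'.ne' (k / n : ℝ), smul_eq_mul, ← mul_assoc,
        one_div_mul_cancel hn'.ne', one_mul]
      congr 1
      · simp
      · push_cast; ring
    rw [Finset.sum_congr rfl h1, intervalIntegral.sum_integral_adjacent_intervals (f := g)
      fun k _ => hint (fun u => u) measurable_id _ _]
    simp [hn'.ne']
  have hI := (IntervalIntegrable.sum (Finset.range n) hkint)
  rw [intervalIntegrable_iff_integrableOn_Ioc_of_le zero_le_one] at hI
  obtain ⟨t, ht, h⟩ := exists_setAverage_le (μ := volume) (s := Ioc (0 : ℝ) 1) (by simp) (by simp) hI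
  refine ⟨t, Ioc_subset_Icc_self ht, ?_⟩
  rw [← heq, intervalIntegral.integral_of_le zero_le_one]
  simpa [setAverage_eq] using h

theorem intervalIntegral_le_concaveClosure {F : ProbabilityMeasure ℝ} {J : Set ℝ}
    (hJ : J.OrdConnected) (hF : HasFullSupportOn (F : Measure ℝ) J) {τ : ℝ}
    (hτ : τ ∈ Ioo (0 : ℝ) 1)
    {r : Kernel (ProbabilityMeasure ℝ) ℝ} (hr : IsQuantileSelectionRule τ r) {f : ℝ → ℝ}
    {w : ProbabilityMeasure ℝ → ℝ} (hw : ∀ G, w G = ∫ x, f x ∂(r G)) {X : ℝ → ℝ}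
    (hX : ∀ u ∈ Ioo (0 : ℝ) 1, ∃ v, τ * u ≤ v ∧ v ≤ τ + (1 - τ) * u ∧ IsCrossing F v (X u))
    (hm : Measurable fun u => f (X u)) {K : ℝ} (hK : ∀ u, |f (X u)| ≤ K) :
    ((∫ u in (0 : ℝ)..1, f (X u) : ℝ) : EReal) ≤ concaveClosure w F := by
  set M := f (quantile F τ)
  have key : ∀ N : ℕ, (((∫ u in (0 : ℝ)..1, f (X u)) - 2 * (K + |M|) * (1 / (N + 2)) : ℝ) : EReal)
      ≤ concaveClosure w F := by
    intro N
    obtain ⟨t, ht, h⟩ := exists_integral_le_riemann_sum hm hK (n := N + 2) (by omega)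
    refine le_trans (EReal.coe_le_coe_iff.2 ?_)
      -- The two dropped cells cost at most `2 K / (N + 2)`, and the leftover posterior at most `2
      -- |M| / (N + 2)`.
      (riemann_sum_le_concaveClosure hJ hF hτ hr hw hX N ht)
    rw [Finset.sum_range_succ, Finset.sum_range_succ'] at h
    push_cast at h
    have hn : (0 : ℝ) < 1 / (N + 2) := by positivity
    have e1 := mul_le_mul_of_nonneg_left ((le_abs_self _).trans (hK ((0 + t) / (N + 2)))) hn.le
    have e2 := mul_le_mul_of_nonneg_left ((le_abs_self _).trans (hK ((N + 1 + t) / (N + 2)))) hn.le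
    have e3 := mul_le_mul_of_nonneg_left (neg_abs_le M) hn.le
    have e4 : 2 / ((N : ℝ) + 2) * M = 2 * (1 / (N + 2) * M) := by ring
    rw [e4]
    linarith
  have hlim : Tendsto (fun N : ℕ => (∫ u in (0 : ℝ)..1, f (X u)) - 2 * (K + |M|) * (1 / (N + 2)))
      atTop (𝓝 (∫ u in (0 : ℝ)..1, f (X u))) := by
    have h := ((tendsto_one_div_add_atTop_nhds_zero_nat (𝕜 := ℝ)).comp (tendsto_add_atTop_nat 1))
    have h2 : Tendsto (fun N : ℕ => 1 / ((N : ℝ) + 2)) atTop (𝓝 0) := by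
      refine h.congr fun N => ?_
      simp only [Function.comp, Nat.cast_add, Nat.cast_one]
      ring
    simpa using (h2.const_mul (2 * (K + |M|))).const_sub (∫ u in (0 : ℝ)..1, f (X u))
  exact le_of_tendsto' ((continuous_coe_real_ereal.tendsto _).comp hlim) key

/-! ### From the truncation interval to the concave closure -/

theorem exists_cdf_eq_of_mem_monotoneInterval {F : ProbabilityMeasure ℝ} {τ : ℝ}
    (hτ : τ ∈ Ioo (0 : ℝ) 1) {H : StieltjesFunction ℝ}
    (hH : H ∈ monotoneInterval (rightTruncation τ F) (leftTruncation τ F)) :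
    ∃ P : ProbabilityMeasure ℝ, (P : Measure ℝ) = H.measure ∧ ∀ x, cdf (P : Measure ℝ) x = H x := by
  have hτ1 : 1 - τ ≠ 0 := (sub_pos.2 hτ.2).ne'
  have hb : Tendsto H atBot (𝓝 0) := by
    have h : Tendsto (leftTruncation τ F) atBot (𝓝 0) := by
      have := ((tendsto_cdf_atBot (F : Measure ℝ)).const_mul (1 / τ)).min
        (tendsto_const_nhds (x := (1 : ℝ)))
      rw [mul_zero, min_eq_left zero_le_one] at this
      exact this
    exact tendsto_of_tendsto_of_tendsto_of_le_of_le tendsto_const_nhds h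
      (fun x => (le_max_right _ _).trans (hH x).1) fun x => (hH x).2
  have ht : Tendsto H atTop (𝓝 1) := by
    have h : Tendsto (rightTruncation τ F) atTop (𝓝 1) := by
      have := (((tendsto_cdf_atTop (F : Measure ℝ)).sub_const τ).div_const (1 - τ)).max
        (tendsto_const_nhds (x := (0 : ℝ)))
      rw [div_self hτ1, max_eq_left zero_le_one] at this
      exact this
    exact tendsto_of_tendsto_of_tendsto_of_le_of_le h tendsto_const_nhds
      (fun x => (hH x).1) fun x => (hH x).2.trans (min_le_right _ _)
  refine ⟨⟨H.measure, H.isProbabilityMeasure hb ht⟩, rfl, fun x => ?_⟩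
  exact congrArg (fun f : StieltjesFunction ℝ => f x) (cdf_measure_stieltjesFunction H hb ht)

/-- The quantile function, extended by zero. -/
noncomputable def quantileIoo (P : ProbabilityMeasure ℝ) : ℝ → ℝ :=
  (Ioo (0 : ℝ) 1).indicator (quantile P)

theorem quantileIoo_of_mem (P : ProbabilityMeasure ℝ) {u : ℝ} (hu : u ∈ Ioo (0 : ℝ) 1) :
    quantileIoo P u = quantile P u := indicator_of_mem hu _

theorem measurable_quantileIoo (P : ProbabilityMeasure ℝ) : Measurable (quantileIoo P) := by
  refine measurable_of_Iic fun x => ?_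
  have : quantileIoo P ⁻¹' Iic x = (Ioo 0 1 ∩ Iic (cdf (P : Measure ℝ) x)) ∪
      ((Ioo 0 1)ᶜ ∩ {_u : ℝ | (0 : ℝ) ≤ x}) := by
    ext u
    by_cases hu : u ∈ Ioo (0 : ℝ) 1
    · simp only [mem_preimage, mem_Iic, quantileIoo_of_mem P hu, quantile_le_iff P hu, mem_union,
        mem_inter_iff, hu, true_and, mem_compl_iff, not_true, false_and, or_false]
    · simp only [mem_preimage, mem_Iic, quantileIoo, indicator_of_notMem hu, mem_union,
        mem_inter_iff, hu, false_and, mem_compl_iff, not_false_iff, true_and, false_or,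
        mem_ofPred_eq]
  rw [this]
  exact (measurableSet_Ioo.inter measurableSet_Iic).union
    (measurableSet_Ioo.compl.inter (MeasurableSet.const _))

/-- Inverse transform sampling. -/
theorem map_quantileIoo (P : ProbabilityMeasure ℝ) :
    (volume.restrict (Ioo (0 : ℝ) 1)).map (quantileIoo P) = P := by
  have : IsFiniteMeasure ((volume.restrict (Ioo (0 : ℝ) 1)).map (quantileIoo P)) :=
    Measure.isFiniteMeasure_map _ _
  refine Measure.ext_of_Iic _ _ fun x => ?_
  have hset : quantileIoo P ⁻¹' Iic x ∩ Ioo 0 1 = Iic (cdf (P : Measure ℝ) x) ∩ Ioo 0 1 := by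
    ext u
    refine and_congr_left fun hu => ?_
    rw [mem_preimage, quantileIoo_of_mem P hu]
    exact quantile_le_iff P hu x
  rw [Measure.map_apply (measurable_quantileIoo P) measurableSet_Iic,
    Measure.restrict_apply (measurable_quantileIoo P measurableSet_Iic), hset,
    ← Measure.restrict_apply measurableSet_Iic, Measure.restrict_congr_set Ioo_ae_eq_Ioc,
    Measure.restrict_apply measurableSet_Iic, inter_comm, Ioc_inter_Iic,
    min_eq_right (cdf_le_one _ _), Real.volume_Ioc, sub_zero, ofReal_cdf]

/-- Quantiles of `H` outside `B` are moved to the `τ`-quantile of `F`. This is always feasible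
because `τ ∈ [τ u, τ + (1 - τ) u]` for every `u`, and it makes the integrand bounded. -/
theorem integral_piecewise_le_concaveClosure {F : ProbabilityMeasure ℝ} {J : Set ℝ}
    (hJ : J.OrdConnected) (hF : HasFullSupportOn (F : Measure ℝ) J) {τ : ℝ}
    (hτ : τ ∈ Ioo (0 : ℝ) 1)
    {r : Kernel (ProbabilityMeasure ℝ) ℝ} (hr : IsQuantileSelectionRule τ r) {f : ℝ → ℝ}
    (hf : Measurable f) {w : ProbabilityMeasure ℝ → ℝ} (hw : ∀ G, w G = ∫ x, f x ∂(r G))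
    {H : StieltjesFunction ℝ}
    (hH : H ∈ monotoneInterval (rightTruncation τ F) (leftTruncation τ F))
    {B : Set ℝ} (hB : MeasurableSet B) {K : ℝ} (hK : ∀ x ∈ B, |f x| ≤ K)
    [DecidablePred (· ∈ B)] :
    ((∫ x, B.piecewise f (fun _ => f (quantile F τ)) x ∂H.measure : ℝ) : EReal) ≤
      concaveClosure w F := by
  have hτ1 : 0 < 1 - τ := sub_pos.2 hτ.2
  obtain ⟨P, hP, hcdf⟩ := exists_cdf_eq_of_mem_monotoneInterval hτ hH
  set g := B.piecewise f fun _ => f (quantile F τ) with hg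
  have hgm : Measurable g := hf.piecewise hB measurable_const
  set X : ℝ → ℝ := fun u => if quantileIoo P u ∈ B then quantileIoo P u else quantile F τ with hX
  have hfX : ∀ u, f (X u) = g (quantileIoo P u) := fun u => by
    by_cases h : quantileIoo P u ∈ B
    · simp only [hX, if_pos h, hg, piecewise_eq_of_mem _ _ _ h]
    · simp only [hX, if_neg h, hg, piecewise_eq_of_notMem _ _ _ h]
  have key := intervalIntegral_le_concaveClosure hJ hF hτ hr hw (X := X)
    (K := max K |f (quantile F τ)|) ?_ ?_ ?_
  · simp_rw [hfX] at key
    rwa [intervalIntegral.integral_of_le zero_le_one, integral_Ioc_eq_integral_Ioo,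
      ← integral_map (f := g) (measurable_quantileIoo P).aemeasurable hgm.aestronglyMeasurable,
      map_quantileIoo, hP] at key
  · intro u hu
    by_cases h : quantileIoo P u ∈ B
    · simp only [hX, if_pos h]
      rw [quantileIoo_of_mem P hu]
      refine exists_isCrossing_of_truncation hJ hF hτ hu ?_ fun y hy => ?_
      · have h1 := (quantile_le_iff P hu _).1 le_rfl
        rw [hcdf] at h1
        have h2 := h1.trans ((hH _).2.trans (min_le_left _ _))
        rwa [one_div, ← div_eq_inv_mul, le_div_iff₀ hτ.1, mul_comm] at h2
      · have h1 := (lt_quantile_iff P hu _).1 hy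
        rw [hcdf] at h1
        have h2 := (le_max_left _ _).trans ((hH y).1.trans h1.le)
        rw [div_le_iff₀ hτ1] at h2
        linarith
    · simp only [hX, if_neg h]
      exact ⟨τ, mul_le_of_le_one_right hτ.1.le hu.2.le,
        le_add_of_nonneg_right (mul_nonneg hτ1.le hu.1.le), isCrossing_quantile hJ hF hτ⟩
  · simp_rw [hfX]
    exact hgm.comp (measurable_quantileIoo P)
  · intro u
    by_cases h : quantileIoo P u ∈ B
    · simp only [hX, if_pos h]
      exact (hK _ h).trans (le_max_left _ _)
    · simp only [hX, if_neg h]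
      exact le_max_right _ _

/-! ### Unbounded integrands -/

theorem extIntegral_of_integrable {α : Type*} [MeasurableSpace α] {f : α → ℝ} {μ : Measure α}
    (hf : Integrable f μ) : extIntegral f μ = ((∫ x, f x ∂μ : ℝ) : EReal) := by
  have h1 : ∫⁻ x, ENNReal.ofReal (f x) ∂μ ≠ ⊤ := hf.lintegral_lt_top.ne
  have h2 : ∫⁻ x, ENNReal.ofReal (-f x) ∂μ ≠ ⊤ := hf.neg.lintegral_lt_top.ne
  rw [extIntegral, integral_eq_lintegral_pos_part_sub_lintegral_neg_part hf, EReal.coe_sub,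
    EReal.coe_ennreal_toReal h1, EReal.coe_ennreal_toReal h2]

theorem extIntegral_eq_bot {α : Type*} [MeasurableSpace α] {f : α → ℝ} {μ : Measure α}
    (hf : ∫⁻ x, ENNReal.ofReal (-f x) ∂μ = ⊤) : extIntegral f μ = ⊥ := by
  rw [extIntegral, hf, EReal.coe_ennreal_top, EReal.sub_top]

theorem integrable_of_lintegral_ofReal_ne_top {α : Type*} [MeasurableSpace α] {f : α → ℝ}
    {μ : Measure α} (hf : AEStronglyMeasurable f μ) (h1 : ∫⁻ x, ENNReal.ofReal (f x) ∂μ ≠ ⊤)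
    (h2 : ∫⁻ x, ENNReal.ofReal (-f x) ∂μ ≠ ⊤) : Integrable f μ := by
  refine ⟨hf, ?_⟩
  rw [hasFiniteIntegral_iff_norm]
  have : ∀ x, ENNReal.ofReal ‖f x‖ ≤ ENNReal.ofReal (f x) + ENNReal.ofReal (-f x) := fun x => by
    rw [Real.norm_eq_abs]
    rcases abs_choice (f x) with h | h <;> rw [h]
    · exact le_self_add
    · exact le_add_self
  refine (lintegral_mono this).trans_lt ?_
  rw [lintegral_add_left' hf.aemeasurable.ennreal_ofReal]
  exact ENNReal.add_lt_top.2 ⟨h1.lt_top, h2.lt_top⟩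

/-- The negative part may diverge too. Only the values of `f` in `[0, n]` are kept, and the rest is
moved to the constant `M` at a loss of at most `|M|`, so the truncated integrals still tend to
infinity. -/
theorem concaveClosure_eq_top {F : ProbabilityMeasure ℝ} {J : Set ℝ}
    (hJ : J.OrdConnected) (hF : HasFullSupportOn (F : Measure ℝ) J) {τ : ℝ}
    (hτ : τ ∈ Ioo (0 : ℝ) 1)
    {r : Kernel (ProbabilityMeasure ℝ) ℝ} (hr : IsQuantileSelectionRule τ r) {f : ℝ → ℝ}
    (hf : Measurable f) {w : ProbabilityMeasure ℝ → ℝ} (hw : ∀ G, w G = ∫ x, f x ∂(r G))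
    {H : StieltjesFunction ℝ}
    (hH : H ∈ monotoneInterval (rightTruncation τ F) (leftTruncation τ F))
    (htop : ∫⁻ x, ENNReal.ofReal (f x) ∂H.measure = ⊤) : concaveClosure w F = ⊤ := by
  classical
  obtain ⟨P, hP, -⟩ := exists_cdf_eq_of_mem_monotoneInterval hτ hH
  rw [← hP] at htop
  set M := f (quantile F τ) with hM
  set B : ℕ → Set ℝ := fun n => {x | 0 ≤ f x ∧ f x ≤ n} with hBdef
  have hB : ∀ n, MeasurableSet (B n) := fun n =>
    (measurableSet_le measurable_const hf).inter (measurableSet_le hf measurable_const)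
  have hBf : ∀ n, ∀ x ∈ B n, |f x| ≤ n := fun n x hx => by
    rw [abs_of_nonneg hx.1]
    exact hx.2
  have hlim : Tendsto (fun n => ∫⁻ x, (B n).indicator (fun x => ENNReal.ofReal (f x)) x
      ∂(P : Measure ℝ)) atTop (𝓝 ⊤) := by
    rw [← htop]
    refine lintegral_tendsto_of_tendsto_of_monotone
      (fun n => (hf.ennreal_ofReal.indicator (hB n)).aemeasurable)
      (Eventually.of_forall fun x n k hnk => ?_) (Eventually.of_forall fun x => ?_)
    · have hkn : (n : ℝ) ≤ k := by exact_mod_cast hnk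
      exact indicator_le_indicator_of_subset
        (show B n ⊆ B k from fun y hy => ⟨hy.1, hy.2.trans hkn⟩)
        (fun _ => zero_le) x
    · obtain ⟨N, hN⟩ := exists_nat_ge (f x)
      refine tendsto_const_nhds.congr' ?_
      filter_upwards [eventually_ge_atTop N] with n hn
      have hNn : (N : ℝ) ≤ n := by exact_mod_cast hn
      rcases le_total 0 (f x) with h | h
      · rw [indicator_of_mem (show x ∈ B n from ⟨h, hN.trans hNn⟩)]
      · rw [ENNReal.ofReal_of_nonpos h]
        exact (indicator_apply_eq_zero (f := fun x => ENNReal.ofReal (f x)).2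
          fun _ => ENNReal.ofReal_of_nonpos h).symm
  rw [EReal.eq_top_iff_forall_lt]
  intro z
  obtain ⟨n, hn⟩ := (hlim.eventually (lt_mem_nhds
    (ENNReal.ofReal_lt_top (r := |z| + |M| + 1)))).exists
  have key := integral_piecewise_le_concaveClosure hJ hF hτ hr hf hw hH (hB n) (hBf n)
  rw [← hP] at key
  refine lt_of_lt_of_le (EReal.coe_lt_coe_iff.2 ?_) key
  have hint : Integrable ((B n).indicator f) (P : Measure ℝ) := by
    refine Integrable.of_bound (C := n) (hf.indicator (hB n)).aestronglyMeasurable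
      (Eventually.of_forall fun x => ?_)
    by_cases hx : x ∈ B n
    · rw [indicator_of_mem hx]; exact hBf n x hx
    · rw [indicator_of_notMem hx]; simp
  have hint2 : Integrable ((B n).piecewise f fun _ => M) (P : Measure ℝ) := by
    refine Integrable.of_bound (C := max n |M|)
      (hf.piecewise (hB n) measurable_const).aestronglyMeasurable (Eventually.of_forall fun x => ?_)
    by_cases hx : x ∈ B n
    · rw [piecewise_eq_of_mem _ _ _ hx]; exact (hBf n x hx).trans (le_max_left _ _)
    · rw [piecewise_eq_of_notMem _ _ _ hx]; exact le_max_right _ _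
  have h1 : |z| + |M| + 1 < ∫ x, (B n).indicator f x ∂(P : Measure ℝ) := by
    have h0 : ∀ x, 0 ≤ (B n).indicator f x := fun x => indicator_nonneg (fun y hy => hy.1) x
    rw [integral_eq_lintegral_of_nonneg_ae (Eventually.of_forall h0) hint.aestronglyMeasurable]
    refine (ENNReal.ofReal_lt_iff_lt_toReal (by positivity) hint.lintegral_lt_top.ne).1 ?_
    convert hn using 3 with x
    by_cases hx : x ∈ B n
    · rw [indicator_of_mem hx, indicator_of_mem hx]
    · rw [indicator_of_notMem hx, indicator_of_notMem hx, ENNReal.ofReal_zero]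
  have h2 : ∫ x, ((B n).indicator f x - |M|) ∂(P : Measure ℝ) ≤
      ∫ x, (B n).piecewise f (fun _ => M) x ∂(P : Measure ℝ) := by
    refine integral_mono (hint.sub (integrable_const _)) hint2 fun x => ?_
    by_cases hx : x ∈ B n
    · simp only [piecewise_eq_of_mem _ _ _ hx, indicator_of_mem hx]
      linarith [abs_nonneg M]
    · simp only [piecewise_eq_of_notMem _ _ _ hx, indicator_of_notMem hx]
      linarith [neg_abs_le M]
  rw [integral_sub hint (integrable_const _), integral_const, probReal_univ, one_smul] at h2
  linarith [le_abs_self z]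

theorem integral_le_concaveClosure {F : ProbabilityMeasure ℝ} {J : Set ℝ}
    (hJ : J.OrdConnected) (hF : HasFullSupportOn (F : Measure ℝ) J) {τ : ℝ}
    (hτ : τ ∈ Ioo (0 : ℝ) 1)
    {r : Kernel (ProbabilityMeasure ℝ) ℝ} (hr : IsQuantileSelectionRule τ r) {f : ℝ → ℝ}
    (hf : Measurable f) {w : ProbabilityMeasure ℝ → ℝ} (hw : ∀ G, w G = ∫ x, f x ∂(r G))
    {H : StieltjesFunction ℝ}
    (hH : H ∈ monotoneInterval (rightTruncation τ F) (leftTruncation τ F))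
    (hint : Integrable f H.measure) :
    ((∫ x, f x ∂H.measure : ℝ) : EReal) ≤ concaveClosure w F := by
  classical
  obtain ⟨P, hP, -⟩ := exists_cdf_eq_of_mem_monotoneInterval hτ hH
  set M := f (quantile F τ) with hM
  set B : ℕ → Set ℝ := fun n => {x | |f x| ≤ n} with hBdef
  have hB : ∀ n, MeasurableSet (B n) := fun n =>
    measurableSet_le (continuous_abs.measurable.comp hf) measurable_const
  have key := fun n => integral_piecewise_le_concaveClosure hJ hF hτ hr hf hw hH (hB n)
    (fun x hx => (show |f x| ≤ n from hx))
  rw [← hP] at hint key ⊢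
  have hlim : Tendsto (fun n => ∫ x, (B n).piecewise f (fun _ => M) x ∂(P : Measure ℝ)) atTop
      (𝓝 (∫ x, f x ∂(P : Measure ℝ))) := by
    refine tendsto_integral_of_dominated_convergence (fun x => ‖f x‖ + |M|)
      (fun n => (hf.piecewise (hB n) measurable_const).aestronglyMeasurable)
      (hint.norm.add (integrable_const _)) (fun n => Eventually.of_forall fun x => ?_)
      (Eventually.of_forall fun x => ?_)
    · by_cases hx : x ∈ B n
      · rw [piecewise_eq_of_mem _ _ _ hx]
        exact le_add_of_nonneg_right (abs_nonneg M)
      · rw [piecewise_eq_of_notMem _ _ _ hx]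
        exact le_add_of_nonneg_left (norm_nonneg _)
    · obtain ⟨N, hN⟩ := exists_nat_ge |f x|
      refine tendsto_const_nhds.congr' ?_
      filter_upwards [eventually_ge_atTop N] with n hn
      have hNn : (N : ℝ) ≤ n := by exact_mod_cast hn
      rw [piecewise_eq_of_mem _ _ _ (show x ∈ B n from hN.trans hNn)]
  exact le_of_tendsto' ((continuous_coe_real_ereal.tendsto _).comp hlim) key

theorem extIntegral_le_concaveClosure {F : ProbabilityMeasure ℝ} {J : Set ℝ}
    (hJ : J.OrdConnected) (hF : HasFullSupportOn (F : Measure ℝ) J) {τ : ℝ}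
    (hτ : τ ∈ Ioo (0 : ℝ) 1)
    {r : Kernel (ProbabilityMeasure ℝ) ℝ} (hr : IsQuantileSelectionRule τ r) {f : ℝ → ℝ}
    (hf : Measurable f) {w : ProbabilityMeasure ℝ → ℝ} (hw : ∀ G, w G = ∫ x, f x ∂(r G))
    {H : StieltjesFunction ℝ}
    (hH : H ∈ monotoneInterval (rightTruncation τ F) (leftTruncation τ F)) :
    extIntegral f H.measure ≤ concaveClosure w F := by
  by_cases h1 : ∫⁻ x, ENNReal.ofReal (f x) ∂H.measure = ⊤
  · rw [concaveClosure_eq_top hJ hF hτ hr hf hw hH h1]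
    exact le_top
  by_cases h2 : ∫⁻ x, ENNReal.ofReal (-f x) ∂H.measure = ⊤
  · rw [extIntegral_eq_bot h2]
    exact bot_le
  have hint := integrable_of_lintegral_ofReal_ne_top hf.aestronglyMeasurable h1 h2
  rw [extIntegral_of_integrable hint]
  exact integral_le_concaveClosure hJ hF hτ hr hf hw hH hint

/-! ### From signals to the truncation interval -/

theorem measurable_cdf_apply (x : ℝ) :
    Measurable fun G : ProbabilityMeasure ℝ => cdf (G : Measure ℝ) x := by
  simp_rw [cdf_eq_real, measureReal_def]
  exact ((Measure.measurable_coe measurableSet_Iic).comp measurable_subtype_coe).ennreal_toReal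

theorem integrable_cdf_apply (μ : Measure (ProbabilityMeasure ℝ)) [IsFiniteMeasure μ] (x : ℝ) :
    Integrable (fun G : ProbabilityMeasure ℝ => cdf (G : Measure ℝ) x) μ :=
  Integrable.of_bound (C := 1) (measurable_cdf_apply x).aestronglyMeasurable
    (Eventually.of_forall fun G => by
      rw [Real.norm_eq_abs, abs_of_nonneg (cdf_nonneg _ _)]
      exact cdf_le_one _ _)

/-- The distribution of the selected posterior `τ`-quantile lies between the truncations of the
prior. -/
theorem IsSignal.exists_mem_monotoneInterval {F : ProbabilityMeasure ℝ} {τ : ℝ}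
    (hτ : τ ∈ Ioo (0 : ℝ) 1) {r : Kernel (ProbabilityMeasure ℝ) ℝ}
    (hr : IsQuantileSelectionRule τ r) {μ : Measure (ProbabilityMeasure ℝ)} (hμ : IsSignal F μ) :
    ∃ H ∈ monotoneInterval (rightTruncation τ F) (leftTruncation τ F),
      H.measure = μ.bind r := by
  have := hr.1
  have := hμ.1
  have hprob : IsProbabilityMeasure (μ.bind r) :=
    isProbabilityMeasure_bind r.measurable.aemeasurable (Eventually.of_forall fun G => inferInstance)
  have hrm : ∀ x, Measurable fun G => (r G).real (Iic x) := fun x =>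
    (r.measurable_coe measurableSet_Iic).ennreal_toReal
  have hri : ∀ x, Integrable (fun G => (r G).real (Iic x)) μ := fun x =>
    Integrable.of_bound (C := 1) (hrm x).aestronglyMeasurable (Eventually.of_forall fun G => by
      rw [Real.norm_eq_abs, abs_of_nonneg measureReal_nonneg]
      exact measureReal_le_one)
  have hcdf : ∀ x, cdf (μ.bind r) x = ∫ G, (r G).real (Iic x) ∂μ := fun x => by
    rw [cdf_eq_real, measureReal_def,
      Measure.bind_apply measurableSet_Iic r.measurable.aemeasurable]
    exact (integral_toReal (r.measurable_coe measurableSet_Iic).aemeasurable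
      (Eventually.of_forall fun G => measure_lt_top _ _)).symm
  refine ⟨cdf (μ.bind r), fun x => ⟨max_le ?_ (cdf_nonneg _ _), le_min ?_ (cdf_le_one _ _)⟩,
    measure_cdf _⟩
  · rw [hcdf]
    have h := integral_mono (((integrable_cdf_apply μ x).sub (integrable_const τ)).div_const (1 - τ))
      (hri x) fun G => hr.le_real_Iic hτ G x
    simp only [Pi.sub_apply] at h
    rwa [integral_div, integral_sub (integrable_cdf_apply μ x) (integrable_const τ), hμ.2,
      integral_const, probReal_univ, one_smul] at h
  · rw [hcdf]
    have h := integral_mono (hri x) ((integrable_cdf_apply μ x).const_mul (1 / τ))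
      fun G => hr.real_Iic_le hτ G x
    rwa [integral_const_mul, hμ.2] at h

/-- A value at the prior in the convex hull of the graph is attained by a signal under which `f`
is integrable. -/
theorem exists_isSignal_of_mem_convexHull {F : ProbabilityMeasure ℝ}
    {r : Kernel (ProbabilityMeasure ℝ) ℝ} {f : ℝ → ℝ} (hf : Measurable f)
    {w : ProbabilityMeasure ℝ → ℝ} (hw : ∀ G, Integrable f (r G) ∧ w G = ∫ x, f x ∂(r G))
    {z : ℝ} (hz : ((cdf (F : Measure ℝ) : ℝ → ℝ), z) ∈ convexHull ℝ
      (range fun G : ProbabilityMeasure ℝ => ((cdf (G : Measure ℝ) : ℝ → ℝ), w G))) :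
    ∃ μ, IsSignal F μ ∧ Integrable w μ ∧ ∫ G, w G ∂μ = z ∧ Integrable f (μ.bind r) := by
  have hwm : StronglyMeasurable w := by
    rw [funext fun G => (hw G).2]
    exact hf.stronglyMeasurable.integral_kernel
  have hem : Measurable fun G => ∫⁻ x, ‖f x‖ₑ ∂(r G) := hf.enorm.lintegral_kernel
  have hwint : ∀ μ : Measure (ProbabilityMeasure ℝ), ∫⁻ G, ∫⁻ x, ‖f x‖ₑ ∂(r G) ∂μ < ⊤ →
      Integrable w μ := fun μ hμ => by
    refine ⟨hwm.aestronglyMeasurable, lt_of_le_of_lt (lintegral_mono fun G => ?_) hμ⟩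
    rw [(hw G).2]
    exact enorm_integral_le_lintegral_enorm _
  -- A convex set containing the graph. Finiteness of the iterated integral of `|f|` is carried
  -- along because it implies integrability of `w` and, at the end, of `f` under `μ.bind r`.
  set C : Set ((ℝ → ℝ) × ℝ) := {q | ∃ μ : Measure (ProbabilityMeasure ℝ), IsProbabilityMeasure μ ∧
    (∀ x, ∫ G : ProbabilityMeasure ℝ, cdf (G : Measure ℝ) x ∂μ = q.1 x) ∧
    ∫ G, w G ∂μ = q.2 ∧ ∫⁻ G, ∫⁻ x, ‖f x‖ₑ ∂(r G) ∂μ < ⊤} with hC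
  have hconv : Convex ℝ C := by
    rintro q₁ ⟨μ₁, p₁, c₁, v₁, e₁⟩ q₂ ⟨μ₂, p₂, c₂, v₂, e₂⟩ a b ha hb hab
    refine ⟨ENNReal.ofReal a • μ₁ + ENNReal.ofReal b • μ₂, ⟨?_⟩, fun x => ?_, ?_, ?_⟩
    · simp [← ENNReal.ofReal_add ha hb, hab]
    · rw [integral_add_measure ((integrable_cdf_apply μ₁ x).smul_measure ENNReal.ofReal_ne_top)
        ((integrable_cdf_apply μ₂ x).smul_measure ENNReal.ofReal_ne_top), integral_smul_measure,
        integral_smul_measure, c₁, c₂, ENNReal.toReal_ofReal ha, ENNReal.toReal_ofReal hb]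
      simp
    · rw [integral_add_measure ((hwint μ₁ e₁).smul_measure ENNReal.ofReal_ne_top)
        ((hwint μ₂ e₂).smul_measure ENNReal.ofReal_ne_top), integral_smul_measure,
        integral_smul_measure, v₁, v₂, ENNReal.toReal_ofReal ha, ENNReal.toReal_ofReal hb]
      simp
    · rw [lintegral_add_measure, lintegral_smul_measure, lintegral_smul_measure]
      exact ENNReal.add_lt_top.2 ⟨ENNReal.mul_lt_top ENNReal.ofReal_lt_top e₁,
        ENNReal.mul_lt_top ENNReal.ofReal_lt_top e₂⟩
  have hsub : (range fun G : ProbabilityMeasure ℝ => ((cdf (G : Measure ℝ) : ℝ → ℝ), w G)) ⊆ C := by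
    rintro _ ⟨G, rfl⟩
    refine ⟨Measure.dirac G, inferInstance, fun x => ?_, ?_, ?_⟩
    · exact integral_dirac' _ _ (measurable_cdf_apply x).stronglyMeasurable
    · exact integral_dirac' _ _ hwm
    · rw [lintegral_dirac' _ hem]
      exact (hw G).1.2
  obtain ⟨μ, p, c, v, e⟩ := convexHull_min hsub hconv hz
  refine ⟨μ, ⟨p, c⟩, hwint μ e, v, hf.aestronglyMeasurable, ?_⟩
  rw [HasFiniteIntegral, Measure.lintegral_bind r.measurable.aemeasurable hf.enorm.aemeasurable]
  exact e

theorem concaveClosure_le_persuasionValue {F : ProbabilityMeasure ℝ}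
    {r : Kernel (ProbabilityMeasure ℝ) ℝ} {f : ℝ → ℝ} (hf : Measurable f)
    {w : ProbabilityMeasure ℝ → ℝ} (hw : ∀ G, Integrable f (r G) ∧ w G = ∫ x, f x ∂(r G)) :
    concaveClosure w F ≤ persuasionValue w F := by
  refine iSup₂_le fun z hz => ?_
  obtain ⟨μ, hμ, hwμ, rfl, -⟩ := exists_isSignal_of_mem_convexHull hf hw hz
  rw [← extIntegral_of_integrable hwμ]
  exact le_iSup₂ (f := fun μ (_ : IsSignal F μ) => extIntegral w μ) μ hμ

theorem integral_bind_kernel {α β : Type*} [MeasurableSpace α] [MeasurableSpace β] {μ : Measure α}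
    {κ : Kernel α β} {f : β → ℝ} (hf : Integrable f (μ.bind κ)) :
    ∫ x, f x ∂(μ.bind κ) = ∫ a, ∫ x, f x ∂(κ a) ∂μ := by
  rw [Measure.comp_eq_comp_const_apply] at hf ⊢
  rw [Kernel.integral_comp hf, Kernel.const_apply]

theorem integrable_integral_of_bind_kernel {α β : Type*} [MeasurableSpace α] [MeasurableSpace β]
    {μ : Measure α} {κ : Kernel α β} {f : β → ℝ} (hf : Integrable f (μ.bind κ)) :
    Integrable (fun a => ∫ x, f x ∂(κ a)) μ := by
  rw [Measure.comp_eq_comp_const_apply] at hf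
  simpa using hf.integral_comp

theorem concaveClosure_le_iSup_extIntegral {F : ProbabilityMeasure ℝ} {τ : ℝ}
    (hτ : τ ∈ Ioo (0 : ℝ) 1) {r : Kernel (ProbabilityMeasure ℝ) ℝ}
    (hr : IsQuantileSelectionRule τ r) {f : ℝ → ℝ} (hf : Measurable f)
    {w : ProbabilityMeasure ℝ → ℝ} (hw : ∀ G, Integrable f (r G) ∧ w G = ∫ x, f x ∂(r G)) :
    concaveClosure w F ≤ ⨆ H ∈ monotoneInterval (rightTruncation τ F) (leftTruncation τ F),
      extIntegral f H.measure := by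
  refine iSup₂_le fun z hz => ?_
  obtain ⟨μ, hμ, -, rfl, hfμ⟩ := exists_isSignal_of_mem_convexHull hf hw hz
  obtain ⟨H, hH, hHμ⟩ := hμ.exists_mem_monotoneInterval hτ hr
  refine le_trans (le_of_eq ?_) (le_iSup₂ (f := fun (H : StieltjesFunction ℝ)
    (_ : H ∈ monotoneInterval (rightTruncation τ F) (leftTruncation τ F)) =>
      extIntegral f H.measure) H hH)
  rw [hHμ, extIntegral_of_integrable hfμ, integral_bind_kernel hfμ]
  simp_rw [(hw _).2]

/-- Cancellation inside `r G` can leave `w` integrable although both parts of `f` diverge under `H`,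
so `extIntegral w μ` cannot simply be replaced by `extIntegral f H.measure`. If the positive part of
`f` diverges, the concave closure is `⊤`. If only the negative part does, so does that of `w`. -/
theorem extIntegral_le_concaveClosure_of_isSignal {F : ProbabilityMeasure ℝ} {J : Set ℝ}
    (hJ : J.OrdConnected) (hF : HasFullSupportOn (F : Measure ℝ) J) {τ : ℝ}
    (hτ : τ ∈ Ioo (0 : ℝ) 1) {r : Kernel (ProbabilityMeasure ℝ) ℝ}
    (hr : IsQuantileSelectionRule τ r) {f : ℝ → ℝ} (hf : Measurable f)
    {w : ProbabilityMeasure ℝ → ℝ} (hw : ∀ G, Integrable f (r G) ∧ w G = ∫ x, f x ∂(r G))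
    {μ : Measure (ProbabilityMeasure ℝ)} (hμ : IsSignal F μ) :
    extIntegral w μ ≤ concaveClosure w F := by
  have hw' : ∀ G, w G = ∫ x, f x ∂(r G) := fun G => (hw G).2
  have hwm : StronglyMeasurable w := by
    rw [funext hw']
    exact hf.stronglyMeasurable.integral_kernel
  obtain ⟨H, hH, hHμ⟩ := hμ.exists_mem_monotoneInterval hτ hr
  have hlb : ∀ g : ℝ → ENNReal, Measurable g →
      ∫⁻ x, g x ∂H.measure = ∫⁻ G, ∫⁻ x, g x ∂(r G) ∂μ := fun g hg => by
    rw [hHμ, Measure.lintegral_bind r.measurable.aemeasurable hg.aemeasurable]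
  by_cases h1 : ∫⁻ x, ENNReal.ofReal (f x) ∂H.measure = ⊤
  · rw [concaveClosure_eq_top hJ hF hτ hr hf hw' hH h1]
    exact le_top
  by_cases h2 : ∫⁻ x, ENNReal.ofReal (-f x) ∂H.measure = ⊤
  · refine (extIntegral_eq_bot ?_).trans_le bot_le
    rw [hlb _ hf.ennreal_ofReal] at h1
    rw [hlb (fun x => ENNReal.ofReal (-f x)) hf.neg.ennreal_ofReal] at h2
    -- From `∫ f⁻ = -w G + ∫ f⁺` under `r G`. With `∫ f⁺` finite after averaging over `μ`, the
    -- divergence must come from the negative part of `w`.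
    have hle : ∀ G, ∫⁻ x, ENNReal.ofReal (-f x) ∂(r G) ≤
        ENNReal.ofReal (-w G) + ∫⁻ x, ENNReal.ofReal (f x) ∂(r G) := fun G => by
      have hA : ∫⁻ x, ENNReal.ofReal (f x) ∂(r G) ≠ ⊤ := (hw G).1.lintegral_lt_top.ne
      have hB : ∫⁻ x, ENNReal.ofReal (-f x) ∂(r G) ≠ ⊤ := (hw G).1.neg.lintegral_lt_top.ne
      have hAB := integral_eq_lintegral_pos_part_sub_lintegral_neg_part (hw G).1
      rw [← hw' G] at hAB
      calc ∫⁻ x, ENNReal.ofReal (-f x) ∂(r G)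
          = ENNReal.ofReal (-w G + (∫⁻ x, ENNReal.ofReal (f x) ∂(r G)).toReal) := by
            rw [hAB, ← ENNReal.ofReal_toReal hB]
            congr 1
            rw [ENNReal.ofReal_toReal hB]
            ring
        _ ≤ _ := ENNReal.ofReal_add_le
        _ = _ := by rw [ENNReal.ofReal_toReal hA]
    by_contra h3
    have h4 := lintegral_mono (μ := μ) hle
    have hneg : Measurable fun G => ENNReal.ofReal (-w G) := hwm.measurable.neg.ennreal_ofReal
    rw [h2, lintegral_add_left hneg] at h4
    exact (ENNReal.add_lt_top.2 ⟨Ne.lt_top h3, Ne.lt_top h1⟩).not_ge h4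
  have hint := integrable_of_lintegral_ofReal_ne_top hf.aestronglyMeasurable h1 h2
  have hint' : Integrable f (μ.bind r) := hHμ ▸ hint
  have hwint : Integrable w μ := by
    rw [funext hw']
    exact integrable_integral_of_bind_kernel hint'
  have h := integral_le_concaveClosure hJ hF hτ hr hf hw' hH hint
  rw [hHμ, integral_bind_kernel hint'] at h
  rw [extIntegral_of_integrable hwint]
  rwa [integral_congr_ae (Eventually.of_forall hw')]

theorem proposition2
    (F : ProbabilityMeasure ℝ)
    (hF : ∃ J : Set ℝ, J.OrdConnected ∧ HasFullSupportOn (F : Measure ℝ) J)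
    (τ : ℝ) (hτ : τ ∈ Set.Ioo (0 : ℝ) 1)
    (r : Kernel (ProbabilityMeasure ℝ) ℝ) (hr : IsQuantileSelectionRule τ r)
    (vS : ℝ → ℝ) (hvS : Measurable vS)
    (vHat : ProbabilityMeasure ℝ → ℝ)
    (hvHat : ∀ G : ProbabilityMeasure ℝ,
      Integrable vS (r G) ∧ vHat G = ∫ x, vS x ∂(r G)) :
    concaveClosure vHat F =
        (⨆ H ∈ monotoneInterval (rightTruncation τ F) (leftTruncation τ F),
          extIntegral vS H.measure) ∧
      persuasionValue vHat F =
        ⨆ H ∈ monotoneInterval (rightTruncation τ F) (leftTruncation τ F),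
          extIntegral vS H.measure := by
  obtain ⟨J, hJ, hFJ⟩ := hF
  have hcav : concaveClosure vHat F =
      ⨆ H ∈ monotoneInterval (rightTruncation τ F) (leftTruncation τ F),
        extIntegral vS H.measure :=
    le_antisymm (concaveClosure_le_iSup_extIntegral hτ hr hvS hvHat)
      (iSup₂_le fun H hH =>
        extIntegral_le_concaveClosure hJ hFJ hτ hr hvS (fun G => (hvHat G).2) hH)
  refine ⟨hcav, hcav ▸ le_antisymm (iSup₂_le fun μ hμ => ?_)
    (concaveClosure_le_persuasionValue hvS hvHat)⟩
  exact extIntegral_le_concaveClosure_of_isSignal hJ hFJ hτ hr hvS hvHat hμ
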